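/- **Setting.** Let $d\ge 1$, and let $M\subset\mathbb R^D$ be a nonempty closed (i.e. compact, without boundary) $d$-dimensional $C^2$ (in particular: $C^{2,1}$) submanifold contained in the unit ball, with $d$-dimensional Hausdorff measure at most $V$ and reach at least $\tau$, where $V,\tau>0$. Here the reach of $M$ is the supremum of all $r\ge0$ such that every point at distance at most $r$ from $M$ has a unique nearest point in $M$. Let $\mu$ be the uniform probability measure on $M$ (normalized $d$-dimensional Hausdorff measure), let $G_\sigma$ be the centered Gaussian law on $\mathbb R^D$ with covariance $\sigma^2 I$, $\sigma>0$, let $\omega_d$ be the volume of the unit ball of $\mathbb R^d$, and let $s(b)=\sup_{x\in M} b\cdot x$ for unit vectors $b$. **Algorithm Find-Distance.** Input: $\varepsilon>0$, a unit vector $b\in\mathbb R^D$ and points $X_1,\dots,X_N\in\mathbb R^D$ (the parameters $d,V,\tau,\sigma$ are known). Put $\delta=\varepsilon/16$ and $$\Gamma_\delta=\frac{(\sqrt\delta\,\tau)^d\omega_d}{V}\,\frac1{\sqrt{2\pi}\,\sigma}\exp\Big(-\frac12\Big(\frac{\sigma}{\delta\tau}\log\frac{V}{(\sqrt\delta\,\tau)^d\omega_d}\Big)^2\Big),\qquad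 r_\delta=\frac{\sigma^2}{\delta\tau}\log\frac{V}{(\sqrt\delta\,\tau)^d\omega_d},$$ $j_-=\lfloor\frac1\delta(r_\delta-1-\delta\tau)\rfloor-1$ and $j_+=\lfloor\frac1\delta(r_\delta+1+\delta\tau)\rfloor+1$. Starting from $j=j_-$, repeat: increase $j$ by one and compute $$\Gamma^{est}_{j}=\frac1{N\delta}\#\{i: j\delta<X_i\cdot b\le (j+1)\delta\},$$ until $\Gamma^{est}_{j}\le\Gamma_\delta$ or $j=j_+$. If the loop ends with $\Gamma^{est}_{j}\le\Gamma_\delta$, output $s^{est}(b)=j\delta-r_\delta$; otherwise report failure. **Statement.** There is a polynomial $p$ such that for all $d,D,V,\tau,\sigma$ as above there is $\varepsilon_0>0$, depending only on $d,D,V,\tau,\sigma$, with the following property. Let $0<\varepsilon<\varepsilon_0$, $0<\eta<\frac12$, $\delta=\varepsilon/16$, and let $N$ be an integer with $$N\ \ge\ \bigg(\frac{3\cdot2^{10}\sqrt{2\pi}\,\sigma^2}{\delta^2}\cdot\frac{V}{(\sqrt\varepsilon\,\tau/4)^d\omega_d}\bigg)^3\exp\bigg(\Big(\frac{\sigma}{\varepsilon\tau/16}\log\frac{V}{(\sqrt\varepsilon\,\tau/4)^d\omega_d}\Big)^2\bigg)\log(\eta^{-1}).$$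 Then for every unit vector $b\in\mathbb R^D$: 1. for every such $M$, if $X_1,\dots,X_N$ are independent random points with distribution $\mu*G_\sigma$, then with probability larger than $1-\eta$ the algorithm Find-Distance does not fail and its output satisfies $|s^{est}(b)-s(b)|<\varepsilon$; 2. on every input $X_1,\dots,X_N\in\mathbb R^D$, the algorithm performs at most $p(N)$ arithmetic operations, where additions, subtractions, multiplications, divisions, comparisons and evaluations of $\sqrt{\cdot}$, $\exp$, $\log$ and $\lfloor\cdot\rfloor$ count one operation each. -/

import Mathlib

open MeasureTheory ProbabilityTheory
open scoped ENNReal NNReal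

namespace FindDistance

/-! ### The geometric model -/

/-- The reach of a set `A`: the supremum of all `r ≥ 0` such that every point `x` with
`dist(x, A) ≤ r` has a unique nearest point in `A`. -/
noncomputable def reach {X : Type*} [PseudoEMetricSpace X] (A : Set X) : ℝ≥0∞ :=
  ⨆ (r : ℝ≥0) (_ : ∀ x : X, Metric.infEDist x A ≤ r →
    ∃! y : X, y ∈ A ∧ edist x y = Metric.infEDist x A), (r : ℝ≥0∞)

/-- `M` is an embedded `d`-dimensional `C²` submanifold (without boundary) of `ℝ^D`: around each
of its points there is a `C²` diffeomorphism between open subsets of `ℝ^D` which straightens `M`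
to a `d`-dimensional linear subspace. -/
def IsC2Submanifold (d : ℕ) {D : ℕ} (M : Set (EuclideanSpace ℝ (Fin D))) : Prop :=
  ∀ p ∈ M, ∃ φ : OpenPartialHomeomorph (EuclideanSpace ℝ (Fin D)) (EuclideanSpace ℝ (Fin D)),
    p ∈ φ.source ∧ ContDiffOn ℝ 2 φ φ.source ∧ ContDiffOn ℝ 2 φ.symm φ.target ∧
    ∃ W : Submodule ℝ (EuclideanSpace ℝ (Fin D)), Module.finrank ℝ W = d ∧
      ∀ x ∈ φ.source, φ x ∈ W ↔ x ∈ M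

/-- The manifolds under consideration: nonempty closed (that is, compact without boundary)
`d`-dimensional submanifolds of `ℝ^D` inside the unit ball, with `d`-dimensional Hausdorff measure
(normalized to be Lebesgue measure on `ℝ^d`) at most `V` and reach at least `τ`. -/
structure IsModelManifold (d : ℕ) (V τ : ℝ) {D : ℕ} (M : Set (EuclideanSpace ℝ (Fin D))) :
    Prop where
  nonempty : M.Nonempty
  isClosed : IsClosed M
  isC2Submanifold : IsC2Submanifold d M
  subset_ball : M ⊆ Metric.closedBall 0 1
  volume_le : μHE[d] M ≤ ENNReal.ofReal V
  le_reach : ENNReal.ofReal τ ≤ reach M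

/-- The support function `s(b) = sup_{x ∈ M} b · x`. -/
noncomputable def supportFunction {D : ℕ} (M : Set (EuclideanSpace ℝ (Fin D)))
    (b : EuclideanSpace ℝ (Fin D)) : ℝ :=
  sSup ((fun x => inner ℝ b x) '' M)

/-- The law `μ * G_σ` of a noisy sample: `μ` is the uniform distribution on `M` (normalized
`d`-dimensional Hausdorff measure) and `G_σ` the centered Gaussian with covariance `σ² I`. -/
noncomputable def noisyLaw (d : ℕ) (σ : ℝ) {D : ℕ} (M : Set (EuclideanSpace ℝ (Fin D))) :
    Measure (EuclideanSpace ℝ (Fin D)) :=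
  (ProbabilityTheory.cond (μHE[d]) M).conv
    (multivariateGaussian 0 ((σ ^ 2) • (1 : Matrix (Fin D) (Fin D) ℝ)))

/-- `ω_d`, the volume of the unit ball of `ℝ^d`. -/
noncomputable def unitBallVolume (d : ℕ) : ℝ :=
  (volume (Metric.ball (0 : EuclideanSpace ℝ (Fin d)) 1)).toReal

/-- The lower bound for the number of samples; here `δ = ε / 16`. -/
noncomputable def sampleBound (d : ℕ) (V τ σ ε η : ℝ) : ℝ :=
  let δ := ε / 16
  let ratio := V / ((√ε * τ / 4) ^ d * unitBallVolume d)
  (3 * 2 ^ 10 * √(2 * Real.pi) * σ ^ 2 / δ ^ 2 * ratio) ^ 3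
    * Real.exp ((σ / (ε * τ / 16) * Real.log ratio) ^ 2) * Real.log η⁻¹

/-! ### Computations with a count of arithmetic operations

A real-number machine: each addition, subtraction, multiplication, division, comparison and each
evaluation of `√`, `exp`, `log` and the floor function costs one operation. -/

/-- The result of a computation together with the number of operations it performed. -/
structure Counted (α : Type) where
  val : α
  ops : ℕ

namespace Counted

instance : Monad Counted where
  pure a := ⟨a, 0⟩
  bind x f := ⟨(f x.val).val, x.ops + (f x.val).ops⟩

/-- One elementary operation, with its result. -/
def op {α : Type} (a : α) : Counted α := ⟨a, 1⟩

noncomputable def add (x y : ℝ) : Counted ℝ := op (x + y)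
noncomputable def sub (x y : ℝ) : Counted ℝ := op (x - y)
noncomputable def mul (x y : ℝ) : Counted ℝ := op (x * y)
noncomputable def div (x y : ℝ) : Counted ℝ := op (x / y)
noncomputable def sqrt (x : ℝ) : Counted ℝ := op (√x)
noncomputable def exp (x : ℝ) : Counted ℝ := op (Real.exp x)
noncomputable def log (x : ℝ) : Counted ℝ := op (Real.log x)
noncomputable def floor (x : ℝ) : Counted ℤ := op ⌊x⌋
noncomputable def lt (x y : ℝ) : Counted Bool := op (decide (x < y))
noncomputable def le (x y : ℝ) : Counted Bool := op (decide (x ≤ y))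
def intAdd (i j : ℤ) : Counted ℤ := op (i + j)
def intEq (i j : ℤ) : Counted Bool := op (decide (i = j))

/-- `x ^ n` by repeated multiplication. -/
noncomputable def pow (x : ℝ) : ℕ → Counted ℝ
  | 0 => pure 1
  | n + 1 => do
    let y ← pow x n
    mul y x

/-- The Euclidean inner product of two vectors given by their coordinates. -/
noncomputable def dot {D : ℕ} (x b : EuclideanSpace ℝ (Fin D)) : Counted ℝ :=
  (List.finRange D).foldlM (init := (0 : ℝ)) fun acc k => do
    let t ← mul (x k) (b k)
    add acc t

end Counted

open Counted

/-! ### The algorithm Find-Distance -/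

/-- `Γ^est_{jδ,b} = (1 / (N δ)) * #{i : jδ < X_i · b ≤ (j+1)δ}`. -/
noncomputable def slabDensity {D N : ℕ} (X : Fin N → EuclideanSpace ℝ (Fin D))
    (b : EuclideanSpace ℝ (Fin D)) (δ : ℝ) (j : ℤ) : Counted ℝ := do
  let lower ← mul j δ
  let j' ← intAdd j 1
  let upper ← mul j' δ
  let count ← (List.finRange N).foldlM (init := (0 : ℝ)) fun acc i => do
    let t ← dot (X i) b
    let above ← lt lower t
    let below ← le t upper
    if above && below then add acc 1 else pure acc
  let m ← mul N δ
  div count m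

/-- The loop "increase `j` by one and compute `Γ^est_{jδ,b}`, until `Γ^est_{jδ,b} ≤ Γ` or
`j = jmax`". It returns `j` if it was left because of `Γ^est_{jδ,b} ≤ Γ`, and `none` otherwise.
The argument after `jmax` is the number of passes still available; it is there only to make the
recursion structural (started with `jmax - j > 0` passes at `j`, the loop leaves through one of its
two tests in the last pass at the latest). -/
noncomputable def scan {D N : ℕ} (X : Fin N → EuclideanSpace ℝ (Fin D))
    (b : EuclideanSpace ℝ (Fin D)) (δ Γ : ℝ) (jmax : ℤ) : ℕ → ℤ → Counted (Option ℤ)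
  | 0, _ => pure none
  | passes + 1, j₀ => do
    let j ← intAdd j₀ 1
    let g ← slabDensity X b δ j
    let hit ← le g Γ
    if hit then pure (some j)
    else do
      let last ← intEq j jmax
      if last then pure none else scan X b δ Γ jmax passes j

/-- The algorithm Find-Distance. Besides its inputs `ε`, `b`, `X`, it uses the parameters
`d, V, τ, σ` of the model and the constants `ω_d` and `√(2π)`.
The output is `some s^est(b)`, or `none` if the algorithm reports failure. -/
noncomputable def findDistance (d : ℕ) (V τ σ ε : ℝ) {D N : ℕ} (b : EuclideanSpace ℝ (Fin D))
    (X : Fin N → EuclideanSpace ℝ (Fin D)) : Counted (Option ℝ) := do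
  let δ ← div ε 16
  -- `a = (√δ τ)^d ω_d`, `lg = log (V / a)`, `δτ = δ * τ`
  let sδ ← sqrt δ
  let sδτ ← mul sδ τ
  let pw ← pow sδτ d
  let a ← mul pw (unitBallVolume d)
  let ratio ← div V a
  let lg ← log ratio
  let δτ ← mul δ τ
  -- `Γ_δ = (a / V) * (√(2π) σ)⁻¹ * exp (-(1/2) * (σ / (δτ) * lg)²)`
  let u ← div σ δτ
  let w ← mul u lg
  let w2 ← mul w w
  let e0 ← mul (-1 / 2) w2
  let e ← exp e0
  let frac ← div a V
  let c0 ← mul (√(2 * Real.pi)) σ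
  let c1 ← div frac c0
  let Γδ ← mul c1 e
  -- `r_δ = σ² / (δτ) * lg`
  let σ2 ← mul σ σ
  let v ← div σ2 δτ
  let rδ ← mul v lg
  -- `jmin = ⌊(r_δ - 1 - δτ) / δ⌋ - 1` and `jmax = ⌊(r_δ + 1 + δτ) / δ⌋ + 1`
  let lo0 ← sub rδ 1
  let lo1 ← sub lo0 δτ
  let lo2 ← div lo1 δ
  let lo3 ← floor lo2
  let jmin ← intAdd lo3 (-1)
  let hi0 ← add rδ 1
  let hi1 ← add hi0 δτ
  let hi2 ← div hi1 δ
  let hi3 ← floor hi2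
  let jmax ← intAdd hi3 1
  let result ← scan X b δ Γδ jmax (jmax - jmin).toNat jmin
  match result with
  | none => pure none
  | some j => do
    let t ← mul j δ
    let s ← sub t rδ
    pure (some s)

end FindDistance

open MeasureTheory ProbabilityTheory
open scoped ENNReal NNReal

namespace FindDistance

/-! Project everything to the line spanned by `b`. A sample becomes `b · x`, with `x` uniform on
`M`, plus a one-dimensional Gaussian error, so the mass of a slab is an average of Gaussian masses
with centres at most `s = supportFunction M b`. Write `R`, `r`, `Γ` for `volumeRatio`, `offset`,
`threshold`. At least a fraction `1/R` of `M` lies within depth `δτ` of the extremal hyperplane.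
Moreover `Γ` is the Gaussian density at distance `r` divided by `R`, and `r` is such that going a
further `δτ` outwards costs at least another factor `R`. Hence beyond `s + r + δτ` the density is
below `Γ` even if all of `M` sat at `s`, while inside `s + r - δτ` the cap alone contributes `Γ`.
Room of order `δ` improves this to factors `1/2` and `2` for slab masses (`noisyLaw_upper_slab_le`,
`le_noisyLaw_lower_slab`), so the first slab of low empirical density locates `s + r` up to a few
`δ`.

The bound `1/R` is `volume_cap_ge`. Unique nearest points allow normal segments to be prolonged up
to length `τ` (`infDist_extend`), so open balls of radius `τ` touching `M` from a normal direction
miss `M`. This bounds the depth of `M` near the extremal point, and it makes the tangential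
projection of a small piece of `M` cover a ball of radius `√δ τ`
(`ball_subset_image_orthogonalProjectionOnto`). Projections are 1-Lipschitz, so the piece has at
least the volume of that ball.

Hoeffding's inequality for each slab and a union bound over the passes finish the probabilistic
part; the exponential in `sampleBound` cancels the one in `Γ²`. For small `ε` the sample number `N`
dominates the number of passes, `d` and `D`, which makes the operation count polynomial in `N`
alone. -/

/-! ### Sets with unique nearest points -/

section Reach

open Metric Set

/-- Points at distance less than `τ` from `M` have at most one nearest point in `M`. -/
def UniqueNearest {X : Type*} [PseudoMetricSpace X] (M : Set X) (τ : ℝ) : Prop :=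
  ∀ x : X, infDist x M < τ → ∀ y ∈ M, ∀ y' ∈ M,
    dist x y = infDist x M → dist x y' = infDist x M → y = y'

lemma uniqueNearest_of_le_reach {X : Type*} [PseudoMetricSpace X] {M : Set X} {τ : ℝ}
    (hM : M.Nonempty) (h : ENNReal.ofReal τ ≤ reach M) : UniqueNearest M τ := by
  intro x hx y hy y' hy' hd hd'
  have hx0 : 0 ≤ infDist x M := infDist_nonneg
  have hlt : ENNReal.ofReal (infDist x M) < reach M :=
    lt_of_lt_of_le ((ENNReal.ofReal_lt_ofReal_iff (by linarith)).2 hx) h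
  have htop : infEDist x M ≠ ⊤ := infEDist_ne_top hM
  have hE : infEDist x M = ENNReal.ofReal (infDist x M) := by
    rw [infDist, ENNReal.ofReal_toReal htop]
  unfold reach at hlt
  rw [lt_iSup_iff] at hlt
  obtain ⟨r, hr⟩ := hlt
  rw [lt_iSup_iff] at hr
  obtain ⟨hr1, hr2⟩ := hr
  have key := hr1 x (by rw [hE]; exact hr2.le)
  refine key.unique ⟨hy, ?_⟩ ⟨hy', ?_⟩
  · rw [hE, edist_dist, hd]
  · rw [hE, edist_dist, hd']

/-- A nearest point of `q` is a nearest point of every point `p` between the two. -/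
lemma dist_eq_infDist_of_between {X : Type*} [PseudoMetricSpace X] {M : Set X} {p q y : X}
    (hy : y ∈ M)
    (hq : dist q y = infDist q M) (hb : dist q p + dist p y = dist q y) :
    dist p y = infDist p M := by
  refine le_antisymm ?_ (infDist_le_dist_of_mem hy)
  have := infDist_le_infDist_add_dist (s := M) (x := q) (y := p)
  linarith

variable {E : Type*} [NormedAddCommGroup E] [InnerProductSpace ℝ E]

/-- Moving away from the unique nearest point increases the distance to the set. -/
lemma exists_infDist_lt_infDist_add_smul [ProperSpace E] {M : Set E} (hM : IsClosed M)
    (hne : M.Nonempty) {q w : E}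
    (hw : ∀ m ∈ M, dist q m = infDist q M → 0 < inner ℝ w (q - m)) :
    ∃ h₀ > (0 : ℝ), ∀ h : ℝ, 0 < h → h < h₀ → infDist q M < infDist (q + h • w) M := by
  have hwne : w ≠ 0 := by
    rintro rfl
    obtain ⟨m, hm, hmd⟩ := hM.exists_infDist_eq_dist hne q
    simpa using hw m hm hmd.symm
  have hwpos : 0 < ‖w‖ := norm_pos_iff.2 hwne
  -- By compactness, the points of `M` that a move along `w` may approach are farther away than the
  -- nearest ones by a fixed `κ`; a step of length below `κ` cannot make up for that.
  obtain ⟨κ, hκ, hκM⟩ : ∃ κ > 0, ∀ m ∈ M, inner ℝ w (q - m) ≤ 0 → infDist q M + κ ≤ dist q m := by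
    set S : Set E := (M ∩ {m | inner ℝ w (q - m) ≤ 0}) ∩ closedBall q (infDist q M + 1) with hS
    have hSc : IsCompact S := by
      refine (isCompact_closedBall q _).inter_left ?_
      exact hM.inter (isClosed_le (by fun_prop) continuous_const)
    rcases S.eq_empty_or_nonempty with h | h
    · refine ⟨1, one_pos, fun m hm hmw => ?_⟩
      by_contra hcon
      have : m ∈ S := ⟨⟨hm, hmw⟩, by rw [mem_closedBall, dist_comm]; linarith⟩
      rw [h] at this
      exact this
    · obtain ⟨m₀, hm₀, hmin⟩ := hSc.exists_isMinOn h (f := fun m => dist q m) (by fun_prop)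
      have h1 : infDist q M ≤ dist q m₀ := infDist_le_dist_of_mem hm₀.1.1
      have h2 : infDist q M ≠ dist q m₀ := by
        intro he
        exact absurd (hw m₀ hm₀.1.1 he.symm) (not_lt.2 hm₀.1.2)
      have h3 := lt_of_le_of_ne h1 h2
      refine ⟨min 1 (dist q m₀ - infDist q M), lt_min one_pos (by linarith), fun m hm hmw => ?_⟩
      by_cases hb : dist q m ≤ infDist q M + 1
      · have : dist q m₀ ≤ dist q m := hmin ⟨⟨hm, hmw⟩, by rw [mem_closedBall, dist_comm]; exact hb⟩
        have := min_le_right 1 (dist q m₀ - infDist q M)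
        linarith
      · have := min_le_left 1 (dist q m₀ - infDist q M)
        linarith
  refine ⟨κ / ‖w‖, by positivity, fun h h0 h1 => ?_⟩
  rw [lt_div_iff₀ hwpos] at h1
  obtain ⟨m, hm, hmd⟩ := hM.exists_infDist_eq_dist hne (q + h • w)
  rw [hmd]
  by_cases hi : inner ℝ w (q - m) ≤ 0
  · have h2 := hκM m hm hi
    have h3 : dist q m ≤ dist q (q + h • w) + dist (q + h • w) m := dist_triangle _ _ _
    have h4 : dist q (q + h • w) = h * ‖w‖ := by
      simp [dist_eq_norm, norm_smul, abs_of_pos h0]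
    linarith
  · push Not at hi
    refine lt_of_le_of_lt (infDist_le_dist_of_mem hm) ?_
    rw [dist_eq_norm, dist_eq_norm]
    refine lt_of_pow_lt_pow_left₀ 2 (norm_nonneg _) ?_
    have : q + h • w - m = (q - m) + h • w := by abel
    rw [this, norm_add_sq_real, inner_smul_right, real_inner_comm]
    have : 0 < h * inner ℝ w (q - m) := by positivity
    nlinarith [sq_nonneg ‖h • w‖]

/-- Normal segments can be extended as long as nearest points are unique. -/
lemma infDist_extend [ProperSpace E] {M : Set E} (hM : IsClosed M) (hne : M.Nonempty) {τ : ℝ}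
    (hU : UniqueNearest M τ) {y n : E} (hy : y ∈ M) (hn : ‖n‖ = 1) {t ρ : ℝ}
    (ht : infDist (y + t • n) M = t) (hρ : 0 < ρ) (hρt : ρ ≤ t) (htτ : t + ρ < τ) :
    infDist (y + (t + ρ) • n) M = t + ρ := by
  have htpos : 0 < t := hρ.trans_le hρt
  set p := y + t • n with hp
  -- Let `q` be the point of the ball farthest from `M`, with nearest point `m`. Maximality forces
  -- `q` onto the sphere and makes `q - m` point along the outer normal, so `p` lies between `m` and
  -- `q`; uniqueness at `p` then gives `m = y`.
  obtain ⟨q, hq, hmax⟩ := (isCompact_closedBall p ρ).exists_isMaxOn ⟨p, mem_closedBall_self hρ.le⟩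
    (f := fun x => infDist x M) (continuous_infDist_pt M).continuousOn
  have hmax' : ∀ x, dist x p ≤ ρ → infDist x M ≤ infDist q M := fun x hx => hmax hx
  obtain ⟨m, hm, hmd⟩ := hM.exists_infDist_eq_dist hne q
  have hqp : dist q p ≤ ρ := hq
  have hδ1 : t ≤ infDist q M := ht ▸ hmax' p (by simp [hρ.le])
  have hδ2 : infDist q M ≤ t + ρ := by
    have := infDist_le_infDist_add_dist (s := M) (x := q) (y := p)
    linarith
  have hδpos : 0 < infDist q M := htpos.trans_le hδ1
  set δ := infDist q M with hδ
  set u : E := δ⁻¹ • (q - m) with hu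
  have hqm : q - m = δ • u := by rw [hu, smul_inv_smul₀ hδpos.ne']
  have hnu : ‖u‖ = 1 := by
    rw [hu, norm_smul, ← dist_eq_norm, ← hmd, norm_inv, Real.norm_of_nonneg hδpos.le,
      inv_mul_cancel₀ hδpos.ne']
  have huniq : ∀ m' ∈ M, dist q m' = δ → m' = m := fun m' hm' hd' =>
    hU q (by linarith) m' hm' m hm hd' hmd.symm
  have huu : inner ℝ u u = 1 := by rw [real_inner_self_eq_norm_sq, hnu]; norm_num
  have hstep : ∀ w : E, 0 < inner ℝ w u →
      ∃ h₀ > (0 : ℝ), ∀ h : ℝ, 0 < h → h < h₀ → δ < infDist (q + h • w) M := by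
    intro w hw
    refine exists_infDist_lt_infDist_add_smul hM hne fun m' hm' hd' => ?_
    rw [huniq m' hm' hd', hqm, inner_smul_right]
    positivity
  have hqeq : dist q p = ρ := by
    by_contra hcon
    have hlt : dist q p < ρ := lt_of_le_of_ne hqp hcon
    obtain ⟨h₀, hh₀, hh⟩ := hstep u (by rw [huu]; norm_num)
    set h := min (h₀ / 2) (ρ - dist q p) with hhdef
    have hpos : 0 < h := lt_min (by positivity) (by linarith)
    have h1 := hh h hpos ((min_le_left _ _).trans_lt (by linarith))
    have h2 := hmax' (q + h • u) (by
      have : dist (q + h • u) q = h := by simp [dist_eq_norm, norm_smul, hnu, abs_of_pos hpos]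
      have h3 := dist_triangle (q + h • u) q p
      have h4 := min_le_right (h₀ / 2) (ρ - dist q p)
      linarith)
    linarith
  set e : E := ρ⁻¹ • (q - p) with he
  have hqpe : q - p = ρ • e := by rw [he, smul_inv_smul₀ hρ.ne']
  have hne' : ‖e‖ = 1 := by
    rw [he, norm_smul, ← dist_eq_norm, hqeq, norm_inv, Real.norm_of_nonneg hρ.le,
      inv_mul_cancel₀ hρ.ne']
  clear_value u e
  have hue : u = e := by
    rw [← inner_eq_one_iff_of_norm_eq_one (𝕜 := ℝ) hnu hne']
    by_contra hcon
    have hlt : inner ℝ u e < 1 :=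
      lt_of_le_of_ne (by simpa [hnu, hne'] using real_inner_le_norm u e) hcon
    have hee : inner ℝ e e = 1 := by rw [real_inner_self_eq_norm_sq, hne']; norm_num
    -- If `u ≠ e`, the direction `u - e` has positive product with `u` and negative product with
    -- `e`: it leads away from `M` while staying in the ball.
    obtain ⟨h₀, hh₀, hh⟩ := hstep (u - e) (by
      rw [inner_sub_left, huu, real_inner_comm]; linarith)
    set h := min (h₀ / 2) ρ with hhdef
    have hpos : 0 < h := lt_min (by positivity) hρ
    have h1 := hh h hpos ((min_le_left _ _).trans_lt (by linarith))
    have h2 := hmax' (q + h • (u - e)) (by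
      rw [dist_eq_norm]
      refine (pow_le_pow_iff_left₀ (norm_nonneg _) hρ.le two_ne_zero).1 ?_
      have h3 : q + h • (u - e) - p = ρ • e + h • (u - e) := by rw [← hqpe]; abel
      rw [h3, norm_add_sq_real, norm_smul, norm_smul, hne', inner_smul_left, inner_smul_right,
        mul_pow, mul_pow, norm_sub_sq_real, hnu, hne', inner_sub_right, hee, real_inner_comm u e]
      simp only [Real.norm_eq_abs, sq_abs, conj_trivial]
      have h4 : h ≤ ρ := min_le_right _ _
      have h5 : 0 ≤ h * (ρ - h) * (1 - inner ℝ u e) :=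
        mul_nonneg (mul_nonneg hpos.le (by linarith)) (by linarith)
      nlinarith)
    linarith
  have hpm : p - m = (δ - ρ) • u := by
    have : p - m = (q - m) - (q - p) := by abel
    rw [this, hqm, hqpe, hue, sub_smul]
  -- Here `ρ ≤ t` enters: otherwise `p` could lie beyond `m`.
  have hδρ : 0 ≤ δ - ρ := by linarith
  have hdpm : dist p m = δ - ρ := by
    rw [dist_eq_norm, hpm, norm_smul, hnu, Real.norm_of_nonneg hδρ, mul_one]
  have hpmin : dist p m = infDist p M :=
    dist_eq_infDist_of_between hm hmd.symm (by rw [hqeq, hdpm, ← hmd]; ring)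
  have hpy : dist p y = infDist p M := by
    rw [ht, hp]; simp [dist_eq_norm, norm_smul, hn, abs_of_pos htpos]
  have hmy : m = y := hU p (by linarith) m hm y hy hpmin hpy
  have hδt : δ = t + ρ := by linarith
  have hun : u = n := by
    have h1 : p - y = t • n := by rw [hp]; abel
    rw [← hmy, hpm, hδt, add_sub_cancel_right] at h1
    exact smul_right_injective E htpos.ne' h1
  have : y + (t + ρ) • n = q := by
    rw [← hδt, ← hun, ← hqm, hmy]; abel
  rw [this, ← hδt]

/-- Each use of `infDist_extend` with `ρ = t` doubles the segment, so powers of two times `t₀` reach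
every length below `τ`; shorter segments inherit the property. -/
lemma infDist_normal [ProperSpace E] {M : Set E} (hM : IsClosed M) (hne : M.Nonempty) {τ : ℝ}
    (hU : UniqueNearest M τ) {y n : E} (hy : y ∈ M) (hn : ‖n‖ = 1) {t₀ : ℝ} (ht₀ : 0 < t₀)
    (h₀ : infDist (y + t₀ • n) M = t₀) {t : ℝ} (ht : 0 ≤ t) (htτ : t < τ) :
    infDist (y + t • n) M = t := by
  have hdist : ∀ s : ℝ, 0 ≤ s → dist (y + s • n) y = s := fun s hs => by
    simp [dist_eq_norm, norm_smul, hn, abs_of_nonneg hs]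
  have key : ∀ k : ℕ, ∀ t : ℝ, 0 ≤ t → t < τ → t ≤ 2 ^ k * t₀ → infDist (y + t • n) M = t := by
    intro k
    induction k with
    | zero =>
      intro t ht _ hle
      have := dist_eq_infDist_of_between (p := y + t • n) hy
        ((hdist t₀ ht₀.le).trans h₀.symm) (by
          rw [hdist t ht, hdist t₀ ht₀.le, dist_eq_norm]
          have : y + t₀ • n - (y + t • n) = (t₀ - t) • n := by rw [sub_smul]; abel
          rw [this, norm_smul, hn, Real.norm_of_nonneg (by simpa using hle)]
          ring)
      rw [← this, hdist t ht]
    | succ k ih =>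
      intro t ht htτ hle
      rcases ht.eq_or_lt with rfl | hpos
      · exact ih 0 le_rfl htτ (by positivity)
      · have h1 := ih (t / 2) (by positivity) (by linarith) (by rw [pow_succ] at hle; linarith)
        have := infDist_extend hM hne hU hy hn h1 (ρ := t / 2) (by positivity) le_rfl (by linarith)
        rwa [add_halves] at this
  obtain ⟨k, hk⟩ := pow_unbounded_of_one_lt (t / t₀) (one_lt_two (α := ℝ))
  exact key k t ht htτ ((div_le_iff₀ ht₀).1 hk.le)

/-- The open ball of radius `τ` touching `M` from a normal direction does not meet `M`. -/
lemma two_mul_inner_le_of_normal [ProperSpace E] {M : Set E} (hM : IsClosed M) {τ : ℝ}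
    (hτ : 0 < τ) (hU : UniqueNearest M τ) {y n z : E} (hy : y ∈ M) (hn : ‖n‖ = 1) {t₀ : ℝ}
    (ht₀ : 0 < t₀) (h₀ : infDist (y + t₀ • n) M = t₀) (hz : z ∈ M) :
    2 * τ * inner ℝ n (z - y) ≤ ‖z - y‖ ^ 2 := by
  have key : ∀ t ∈ Ico 0 τ, 2 * t * inner ℝ n (z - y) ≤ ‖z - y‖ ^ 2 := by
    intro t ht
    have h1 := infDist_normal hM ⟨y, hy⟩ hU hy hn ht₀ h₀ ht.1 ht.2
    have h2 : t ≤ ‖t • n - (z - y)‖ := by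
      have := infDist_le_dist_of_mem (x := y + t • n) hz
      rwa [h1, dist_eq_norm, show y + t • n - z = t • n - (z - y) by abel] at this
    have h3 : t ^ 2 ≤ ‖t • n - (z - y)‖ ^ 2 := pow_le_pow_left₀ ht.1 h2 2
    rw [norm_sub_sq_real, norm_smul, hn, inner_smul_left, mul_one, Real.norm_eq_abs, sq_abs] at h3
    simp only [conj_trivial] at h3
    linarith
  -- Uniqueness is available only for `t < τ`; the value `t = τ` follows because the inequality is
  -- closed in `t`.
  have hc : closure (Ico 0 τ) ⊆ {t | 2 * t * inner ℝ n (z - y) ≤ ‖z - y‖ ^ 2} :=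
    closure_minimal key (isClosed_le (by fun_prop) (by fun_prop))
  rw [closure_Ico hτ.ne] at hc
  exact hc ⟨hτ.le, le_rfl⟩

end Reach

/-! ### Tangent spaces of `C²` submanifolds -/

section Tangent

open Metric Set Filter Topology

/-- A `C²` map agrees with its linearization up to a quadratic error. -/
lemma exists_norm_sub_sub_fderiv_le {E F : Type*} [NormedAddCommGroup E] [NormedSpace ℝ E]
    [NormedAddCommGroup F] [NormedSpace ℝ F] {f : E → F} {x : E} (hf : ContDiffAt ℝ 2 f x) :
    ∃ C : ℝ, 0 ≤ C ∧ ∀ᶠ w in 𝓝 x, ‖f w - f x - fderiv ℝ f x (w - x)‖ ≤ C * ‖w - x‖ ^ 2 := by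
  have h1 : ContDiffAt ℝ 1 (fderiv ℝ f) x := hf.fderiv_right (by norm_num)
  obtain ⟨K, t, ht, hK⟩ := h1.exists_lipschitzOnWith
  have h2 : ∀ᶠ w in 𝓝 x, DifferentiableAt ℝ f w :=
    (hf.eventually (by simp)).mono fun w hw => hw.differentiableAt (by norm_num)
  obtain ⟨ε, hε, hball⟩ := Metric.mem_nhds_iff.1 (inter_mem ht h2)
  refine ⟨K, K.2, ?_⟩
  filter_upwards [ball_mem_nhds x hε] with w hw
  have hsub : closedBall x ‖w - x‖ ⊆ ball x ε := by
    intro z hz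
    rw [mem_closedBall] at hz
    rw [mem_ball, dist_eq_norm] at hw
    rw [mem_ball]; linarith
  have hx : x ∈ t := mem_of_mem_nhds ht
  -- Mean value inequality on the ball of radius `‖w - x‖`, where the derivative varies by at most
  -- `K * ‖w - x‖`.
  have := (convex_closedBall x ‖w - x‖).norm_image_sub_le_of_norm_hasFDerivWithin_le'
    (f := f) (f' := fderiv ℝ f) (φ := fderiv ℝ f x) (C := K * ‖w - x‖)
    (fun z hz => (hball (hsub hz)).2.hasFDerivAt.hasFDerivWithinAt)
    (fun z hz => by
      have h3 := hK.dist_le_mul z (hball (hsub hz)).1 x hx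
      rw [dist_eq_norm] at h3
      exact h3.trans (by gcongr; exact hz))
    (mem_closedBall_self (norm_nonneg _)) (y := w) (by rw [mem_closedBall, dist_eq_norm])
  rw [pow_two, ← mul_assoc]
  exact this

variable {D d : ℕ} {M : Set (EuclideanSpace ℝ (Fin D))}

/-- The `d`-dimensional tangent space of a submanifold at one of its points, with the three
properties that are used below: normal vectors at `y` have `y` as nearest point for a short while,
the projection to the tangent space is locally onto, and derivatives of functions vanish on the
tangent space at local minima. -/
lemma IsC2Submanifold.exists_tangent (hM : IsC2Submanifold d M) {y : EuclideanSpace ℝ (Fin D)}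
    (hy : y ∈ M) :
    ∃ T : Submodule ℝ (EuclideanSpace ℝ (Fin D)), Module.finrank ℝ T = d ∧
      (∀ n : EuclideanSpace ℝ (Fin D), ‖n‖ = 1 → (∀ v ∈ T, inner ℝ n v = 0) →
        ∃ t₀ > 0, infDist (y + t₀ • n) M = t₀) ∧
      (∀ U ∈ 𝓝 y, (fun z => T.orthogonalProjectionOnto (z - y)) '' (M ∩ U) ∈ 𝓝 (0 : T)) ∧
      (∀ (g : EuclideanSpace ℝ (Fin D) → ℝ) (g' : EuclideanSpace ℝ (Fin D) →L[ℝ] ℝ),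
        HasFDerivAt g g' y → IsLocalMinOn g M y → ∀ v ∈ T, g' v = 0) := by
  obtain ⟨φ, hys, hφ, hψ, W, hW, hWM⟩ := hM y hy
  have hψy : φ.symm (φ y) = y := φ.left_inv hys
  have hw0 : φ y ∈ φ.target := φ.map_source hys
  have hw0W : φ y ∈ W := (hWM y hys).2 hy
  have hψ2 : ContDiffAt ℝ 2 φ.symm (φ y) := hψ.contDiffAt (φ.open_target.mem_nhds hw0)
  have hφ2 : ContDiffAt ℝ 2 φ y := hφ.contDiffAt (φ.open_source.mem_nhds hys)
  have hA : HasStrictFDerivAt φ.symm (fderiv ℝ φ.symm (φ y)) (φ y) :=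
    hψ2.hasStrictFDerivAt (by norm_num)
  set A := fderiv ℝ φ.symm (φ y) with hAdef
  have hB : HasFDerivAt φ (fderiv ℝ φ y) y := (hφ2.differentiableAt (by norm_num)).hasFDerivAt
  have hBA : (fderiv ℝ φ y).comp A = ContinuousLinearMap.id ℝ _ := by
    rw [← hψy] at hB
    have h1 := hB.comp (φ y) hA.hasFDerivAt
    rw [hψy] at h1
    have h2 : HasFDerivAt (φ ∘ φ.symm) (ContinuousLinearMap.id ℝ _) (φ y) :=
      (hasFDerivAt_id (φ y)).congr_of_eventuallyEq (by
        filter_upwards [φ.open_target.mem_nhds hw0] with w hw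
        exact φ.right_inv hw)
    exact h1.unique h2
  have hAinj : Function.Injective A := Function.LeftInverse.injective (g := fderiv ℝ φ y)
    fun v => congrArg (fun F => F v) hBA
  let T : Submodule ℝ (EuclideanSpace ℝ (Fin D)) := W.map (A : _ →ₗ[ℝ] _)
  have hAT : ∀ w ∈ W, A w ∈ T := fun w hw => Submodule.mem_map_of_mem hw
  refine ⟨T, ?_, ?_, ?_, ?_⟩
  · rw [← hW]
    exact (Submodule.equivMapOfInjective A.toLinearMap hAinj W).finrank_eq.symm
  · intro n hn hnT
    obtain ⟨C, hC, hCe⟩ := exists_norm_sub_sub_fderiv_le hψ2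
    obtain ⟨K, t, ht, hK⟩ := (hφ2.of_le one_le_two).exists_lipschitzOnWith
    have hev : ∀ᶠ z in 𝓝 y, z ∈ M → inner ℝ n (z - y) ≤ C * K ^ 2 * ‖z - y‖ ^ 2 := by
      filter_upwards [hφ2.continuousAt.eventually hCe, ht, φ.open_source.mem_nhds hys]
        with z hz hzt hzs hzM
      rw [φ.left_inv hzs, hψy] at hz
      have h1 : inner ℝ n (A (φ z - φ y)) = 0 :=
        hnT _ (hAT _ (W.sub_mem ((hWM z hzs).2 hzM) hw0W))
      have h2 : inner ℝ n (z - y) = inner ℝ n (z - y - A (φ z - φ y)) := by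
        rw [inner_sub_right n (z - y), h1, sub_zero]
      have h3 := real_inner_le_norm n (z - y - A (φ z - φ y))
      rw [hn, one_mul] at h3
      have h4 := hK.dist_le_mul z hzt y (mem_of_mem_nhds ht)
      rw [dist_eq_norm, dist_eq_norm] at h4
      calc inner ℝ n (z - y) ≤ ‖z - y - A (φ z - φ y)‖ := h2 ▸ h3
        _ ≤ C * ‖φ z - φ y‖ ^ 2 := hz
        _ ≤ C * (K * ‖z - y‖) ^ 2 := by gcongr
        _ = _ := by ring
    obtain ⟨κ, hκ, hball⟩ := Metric.mem_nhds_iff.1 hev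
    -- The first bound keeps points of `M` outside the `κ`-ball at distance at least `t₀`; the
    -- second makes the quadratic height bound sufficient inside it.
    set t₀ := min (κ / 2) (1 / (2 * (C * K ^ 2 + 1))) with ht₀
    have hpos : 0 < t₀ := lt_min (by positivity) (by positivity)
    have hdist : dist (y + t₀ • n) y = t₀ := by
      simp [dist_eq_norm, norm_smul, hn, abs_of_pos hpos]
    refine ⟨t₀, hpos, le_antisymm ((infDist_le_dist_of_mem hy).trans hdist.le) ?_⟩
    refine (le_infDist ⟨y, hy⟩).2 fun {z} hz => ?_
    by_cases hzκ : z ∈ ball y κ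
    · have h1 := hball hzκ hz
      have h2 : t₀ * (2 * (C * K ^ 2 + 1)) ≤ 1 := (le_div_iff₀ (by positivity)).1 (min_le_right _ _)
      rw [dist_eq_norm, show y + t₀ • n - z = t₀ • n - (z - y) by abel]
      refine (pow_le_pow_iff_left₀ hpos.le (norm_nonneg _) two_ne_zero).1 ?_
      rw [norm_sub_sq_real, norm_smul, hn, inner_smul_left, mul_one, Real.norm_eq_abs, sq_abs]
      simp only [conj_trivial]
      have h3 : 2 * t₀ * inner ℝ n (z - y) ≤ 2 * t₀ * (C * K ^ 2 * ‖z - y‖ ^ 2) := by gcongr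
      have h4 : 2 * t₀ * (C * K ^ 2) ≤ 1 := by nlinarith
      have h5 : 2 * t₀ * (C * K ^ 2) * ‖z - y‖ ^ 2 ≤ 1 * ‖z - y‖ ^ 2 := by gcongr
      linarith
    · rw [mem_ball, not_lt] at hzκ
      have h1 := dist_triangle z (y + t₀ • n) y
      have h2 : t₀ ≤ κ / 2 := min_le_left _ _
      rw [dist_comm (y + t₀ • n) z]
      linarith
  · intro U hU
    let w₀ : W := ⟨φ y, hw0W⟩
    let f : W → T := fun w => T.orthogonalProjectionOnto (φ.symm w - y)
    let f' : W →L[ℝ] T := T.orthogonalProjectionOnto.comp (A.comp W.subtypeL)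
    have hf : HasStrictFDerivAt f f' w₀ := by
      refine T.orthogonalProjectionOnto.hasStrictFDerivAt.comp w₀ ?_
      refine HasStrictFDerivAt.sub_const y ?_
      exact HasStrictFDerivAt.comp w₀ (g := φ.symm) (f := W.subtypeL) hA
        W.subtypeL.hasStrictFDerivAt
    have hsurj : (f' : W →ₗ[ℝ] T).range = ⊤ := by
      rw [LinearMap.range_eq_top]
      rintro ⟨v, w, hw, rfl⟩
      refine ⟨⟨w, hw⟩, ?_⟩
      exact Submodule.orthogonalProjectionOnto_mem_subspace_eq_self (K := T) ⟨A w, hAT w hw⟩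
    have hmap := hf.map_nhds_eq_of_surj hsurj
    have hf0 : f w₀ = 0 := by simp [f, w₀, hψy]
    rw [hf0] at hmap
    rw [← hmap]
    have hc : ContinuousAt (fun w : W => φ.symm w) w₀ :=
      ContinuousAt.comp (g := φ.symm) (f := fun w : W => (w : EuclideanSpace ℝ (Fin D)))
        hψ2.continuousAt continuous_subtype_val.continuousAt
    have h1 : ∀ᶠ w : W in 𝓝 w₀, φ.symm w ∈ U := hc.eventually (by
      change ∀ᶠ z in 𝓝 (φ.symm (φ y)), z ∈ U
      rw [hψy]; exact hU)
    have h2 : ∀ᶠ w : W in 𝓝 w₀, (w : EuclideanSpace ℝ (Fin D)) ∈ φ.target :=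
      continuous_subtype_val.continuousAt.eventually (φ.open_target.mem_nhds hw0)
    refine mem_map.2 ?_
    filter_upwards [h1, h2] with w hwU hwt
    refine ⟨φ.symm w, ⟨(hWM _ (φ.map_target hwt)).1 ?_, hwU⟩, rfl⟩
    rw [φ.right_inv hwt]; exact w.2
  · rintro g g' hg hmin _ ⟨w, hw, rfl⟩
    have h1 : HasFDerivAt (fun v : W => g (φ.symm v)) ((g'.comp A).comp W.subtypeL)
        ⟨φ y, hw0W⟩ := by
      refine HasFDerivAt.comp (g := fun v => g (φ.symm v)) (f := W.subtypeL)
        (⟨φ y, hw0W⟩ : W) ?_ W.subtypeL.hasFDerivAt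
      change HasFDerivAt (g ∘ φ.symm) (g'.comp A) (φ y)
      refine HasFDerivAt.comp _ ?_ hA.hasFDerivAt
      rwa [hψy]
    have h2 : IsLocalMin (fun v : W => g (φ.symm v)) ⟨φ y, hw0W⟩ := by
      have hc : ContinuousAt (fun w : W => φ.symm w) ⟨φ y, hw0W⟩ :=
        ContinuousAt.comp (g := φ.symm) (f := fun w : W => (w : EuclideanSpace ℝ (Fin D)))
          hψ2.continuousAt continuous_subtype_val.continuousAt
      have h3 : ∀ᶠ v : W in 𝓝 (⟨φ y, hw0W⟩ : W), φ.symm v ∈ M → g y ≤ g (φ.symm v) :=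
        hc.eventually (p := fun z => z ∈ M → g y ≤ g z) (by
          change ∀ᶠ z in 𝓝 (φ.symm (φ y)), z ∈ M → g y ≤ g z
          rw [hψy]; exact eventually_nhdsWithin_iff.1 hmin)
      have h4 : ∀ᶠ w : W in 𝓝 (⟨φ y, hw0W⟩ : W), (w : EuclideanSpace ℝ (Fin D)) ∈ φ.target :=
        continuous_subtype_val.continuousAt.eventually (φ.open_target.mem_nhds hw0)
      filter_upwards [h3, h4] with v hv hvt
      simp only [hψy]
      refine hv ((hWM _ (φ.map_target hvt)).1 ?_)
      rw [φ.right_inv hvt]; exact v.2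
    exact congrArg (fun F : W →L[ℝ] ℝ => F ⟨w, hw⟩) (h2.hasFDerivAt_eq_zero h1)

end Tangent

/-! ### The cap of a manifold of positive reach in an extremal direction -/

section Cap

open Metric Set Filter Topology

variable {D d : ℕ} {V τ : ℝ} {M : Set (EuclideanSpace ℝ (Fin D))}

lemma IsModelManifold.isCompact (hM : IsModelManifold d V τ M) : IsCompact M :=
  (isCompact_closedBall 0 1).of_isClosed_subset hM.isClosed hM.subset_ball

/-- The reach enlarges the short normal segments to length `τ`. Homogeneity in `n` saves normalizing
later, where differences of projections serve as normals. -/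
lemma IsModelManifold.exists_tangent (hM : IsModelManifold d V τ M) (hτ : 0 < τ)
    {y : EuclideanSpace ℝ (Fin D)} (hy : y ∈ M) :
    ∃ T : Submodule ℝ (EuclideanSpace ℝ (Fin D)), Module.finrank ℝ T = d ∧
      (∀ n : EuclideanSpace ℝ (Fin D), (∀ v ∈ T, inner ℝ n v = 0) → ∀ z ∈ M,
        2 * τ * inner ℝ n (z - y) ≤ ‖n‖ * ‖z - y‖ ^ 2) ∧
      (∀ U ∈ 𝓝 y, (fun z => T.orthogonalProjectionOnto (z - y)) '' (M ∩ U) ∈ 𝓝 (0 : T)) ∧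
      (∀ (g : EuclideanSpace ℝ (Fin D) → ℝ) (g' : EuclideanSpace ℝ (Fin D) →L[ℝ] ℝ),
        HasFDerivAt g g' y → IsLocalMinOn g M y → ∀ v ∈ T, g' v = 0) := by
  obtain ⟨T, hT, h1, h2, h3⟩ := hM.isC2Submanifold.exists_tangent hy
  refine ⟨T, hT, fun n hn z hz => ?_, h2, h3⟩
  rcases eq_or_ne n 0 with rfl | hn0
  · simp
  have hpos : 0 < ‖n‖ := norm_pos_iff.2 hn0
  have hunit : ‖‖n‖⁻¹ • n‖ = 1 := by
    rw [norm_smul, norm_inv, norm_norm, inv_mul_cancel₀ hpos.ne']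
  obtain ⟨t₀, ht₀, h0⟩ := h1 (‖n‖⁻¹ • n) hunit
    fun v hv => by rw [inner_smul_left, hn v hv, mul_zero]
  have := two_mul_inner_le_of_normal hM.isClosed hτ
    (uniqueNearest_of_le_reach hM.nonempty hM.le_reach) hy hunit ht₀ h0 hz
  rw [inner_smul_left, conj_trivial] at this
  have h4 : ‖n‖ * (2 * τ * (‖n‖⁻¹ * inner ℝ n (z - y))) ≤ ‖n‖ * ‖z - y‖ ^ 2 := by gcongr
  calc 2 * τ * inner ℝ n (z - y) = (‖n‖ * ‖n‖⁻¹) * (2 * τ * inner ℝ n (z - y)) := by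
        rw [mul_inv_cancel₀ hpos.ne', one_mul]
    _ ≤ _ := le_trans (le_of_eq (by ring)) h4

/-- Where a linear function attains its maximum on `M`, `M` is separated from that point by at
most the depth of a ball of radius `τ`. -/
lemma IsModelManifold.two_mul_inner_sub_le (hM : IsModelManifold d V τ M) (hτ : 0 < τ)
    {b y z : EuclideanSpace ℝ (Fin D)} (hy : y ∈ M) (hmax : ∀ z ∈ M, inner ℝ b z ≤ inner ℝ b y)
    (hz : z ∈ M) : 2 * τ * inner ℝ b (y - z) ≤ ‖b‖ * ‖z - y‖ ^ 2 := by
  obtain ⟨T, -, h1, -, h3⟩ := hM.exists_tangent hτ hy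
  have hbT : ∀ v ∈ T, inner ℝ (-b) v = 0 := by
    refine h3 (fun z => inner ℝ (-b) z) (innerSL ℝ (-b)) (innerSL ℝ (-b)).hasFDerivAt ?_
    refine IsMinOn.localize fun z hz => ?_
    simpa using hmax z hz
  have := h1 (-b) hbT z hz
  rw [norm_neg, inner_neg_left, ← inner_neg_right, neg_sub] at this
  exact this

lemma IsModelManifold.exists_ne (hM : IsModelManifold d V τ M) (hd : 1 ≤ d) (hτ : 0 < τ)
    (y : EuclideanSpace ℝ (Fin D)) (hy : y ∈ M) : ∃ z ∈ M, z ≠ y := by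
  obtain ⟨T, hT, -, h2, -⟩ := hM.exists_tangent hτ hy
  obtain ⟨κ, hκ, hball⟩ := Metric.mem_nhds_iff.1 (h2 univ univ_mem)
  have : Nontrivial T := Module.nontrivial_of_finrank_pos (R := ℝ) (by omega)
  obtain ⟨v, hv⟩ := _root_.exists_ne (0 : T)
  have hvpos : 0 < ‖v‖ := norm_pos_iff.2 hv
  obtain ⟨z, ⟨hz, -⟩, hzv⟩ := hball (show (κ / 2 / ‖v‖) • v ∈ ball (0 : T) κ by
    rw [mem_ball_zero_iff, norm_smul, Real.norm_of_nonneg (by positivity),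
      div_mul_cancel₀ _ hvpos.ne']
    linarith)
  refine ⟨z, hz, ?_⟩
  rintro rfl
  simp only [sub_self, map_zero] at hzv
  exact smul_ne_zero (by positivity) hv hzv.symm

/-- Let `a`, `b` realize the diameter. The depth inequality at the maximum of `a - b`, tested at
`b`, bounds `2τ` by the diameter, which is at most 2. The assumption `1 ≤ d` excludes isolated
points. -/
lemma IsModelManifold.tau_le_one (hM : IsModelManifold d V τ M) (hd : 1 ≤ d) (hτ : 0 < τ) :
    τ ≤ 1 := by
  have hc := hM.isCompact
  obtain ⟨a, b, ha, hb, hmax'⟩ : ∃ a b, a ∈ M ∧ b ∈ M ∧ ∀ x ∈ M, ∀ y ∈ M, dist x y ≤ dist a b := by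
    obtain ⟨p, hp, hmax⟩ := (hc.prod hc).exists_isMaxOn (hM.nonempty.prod hM.nonempty)
      (f := fun p : EuclideanSpace ℝ (Fin D) × EuclideanSpace ℝ (Fin D) => dist p.1 p.2)
      continuous_dist.continuousOn
    exact ⟨p.1, p.2, hp.1, hp.2, fun x hx y hy => isMaxOn_iff.1 hmax (x, y) (mk_mem_prod hx hy)⟩
  have hpos : 0 < dist a b := by
    obtain ⟨z, hz, hza⟩ := hM.exists_ne hd hτ a ha
    exact (dist_pos.2 hza).trans_le (hmax' z hz a ha)
  obtain ⟨y, hy, hymax⟩ := hc.exists_isMaxOn hM.nonempty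
    (f := fun z => inner ℝ (a - b) z) (by fun_prop)
  have h1 := hM.two_mul_inner_sub_le (b := a - b) hτ hy (fun z hz => hymax hz) hb
  have h2 : inner ℝ (a - b) a ≤ inner ℝ (a - b) y := hymax ha
  have h3 : inner ℝ (a - b) (a - b) ≤ inner ℝ (a - b) (y - b) := by
    rw [inner_sub_right, inner_sub_right _ y]; linarith
  rw [real_inner_self_eq_norm_sq, ← dist_eq_norm] at h3
  have h4 : ‖b - y‖ ≤ dist a b := by rw [← dist_eq_norm]; exact hmax' b hb y hy
  have h5 : dist a b ≤ 2 := by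
    have ha1 := hM.subset_ball ha
    have hb1 := hM.subset_ball hb
    rw [mem_closedBall] at ha1 hb1
    have := dist_triangle_right a b 0
    linarith
  rw [← dist_eq_norm] at h1
  have h6 : 2 * τ * dist a b ^ 2 ≤ dist a b * dist a b ^ 2 := calc
    _ ≤ 2 * τ * inner ℝ (a - b) (y - b) := by gcongr
    _ ≤ dist a b * ‖b - y‖ ^ 2 := h1
    _ ≤ _ := by gcongr
  have h7 : 2 * τ ≤ dist a b := le_of_mul_le_mul_right h6 (pow_pos hpos 2)
  linarith

/-- The part of `M` within distance `√2 ρ` of `x` covers, under projection to the tangent space,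
the ball of radius `ρ`. -/
lemma ball_subset_image_orthogonalProjectionOnto (hM : IsModelManifold d V τ M) (hτ : 0 < τ)
    {x : EuclideanSpace ℝ (Fin D)} (hx : x ∈ M) {ρ : ℝ} (hρ : 0 < ρ) (hρτ : 20 * ρ ≤ τ) :
    ∃ T : Submodule ℝ (EuclideanSpace ℝ (Fin D)), Module.finrank ℝ T = d ∧
      ball (0 : T) ρ ⊆
        (fun z => T.orthogonalProjectionOnto (z - x)) '' (M ∩ closedBall x (√2 * ρ)) := by
  obtain ⟨T, hT, hn, hnhds, -⟩ := hM.exists_tangent hτ hx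
  refine ⟨T, hT, ?_⟩
  set P : EuclideanSpace ℝ (Fin D) → T := fun z => T.orthogonalProjectionOnto (z - x) with hP
  have hPc : Continuous P := by fun_prop
  set r := √2 * ρ with hr
  have hs1 : 1.41 < √2 := Real.lt_sqrt_of_sq_lt (by norm_num)
  have hs2 : √2 < 1.42 := by rw [Real.sqrt_lt' (by norm_num)]; norm_num
  have hrpos : 0 < r := by positivity
  have hr1 : 1.41 * ρ < r := by rw [hr]; gcongr
  have hr2 : r < 1.42 * ρ := by rw [hr]; gcongr
  set K : Set T := P '' (M ∩ closedBall x r) with hK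
  -- points of `M` near `x` are close to the tangent space
  have hheight : ∀ z ∈ M, ‖z - x‖ ≤ r → ‖z - x‖ ≤ 1.04 * ‖P z‖ := by
    intro z hz hzr
    set n := (z - x) - (P z : EuclideanSpace ℝ (Fin D)) with hndef
    have hnT : ∀ v ∈ T, inner ℝ n v = 0 := fun v hv =>
      T.starProjection_inner_eq_zero _ v hv
    have h1 := hn n hnT z hz
    have h2 : inner ℝ n (z - x) = ‖n‖ ^ 2 := by
      have : z - x = n + (P z : EuclideanSpace ℝ (Fin D)) := by rw [hndef]; abel
      rw [this, inner_add_right, hnT _ (P z).2, add_zero, real_inner_self_eq_norm_sq]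
    rw [h2] at h1
    have h3 : 2 * τ * ‖n‖ ≤ ‖z - x‖ ^ 2 := by
      rcases (norm_nonneg n).eq_or_lt with h0 | h0
      · rw [← h0]; simp
      · refine le_of_mul_le_mul_left ?_ h0
        linarith
    have h4 : ‖z - x‖ ≤ ‖n‖ + ‖P z‖ := by
      calc ‖z - x‖ = ‖n + (P z : EuclideanSpace ℝ (Fin D))‖ := by rw [hndef]; congr 1; abel
        _ ≤ _ := norm_add_le _ _
    have h5 : ‖z - x‖ ^ 2 ≤ (1.42 * ρ) * ‖z - x‖ := by
      rw [pow_two]; gcongr; linarith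
    have h6 : 40 * ρ * ‖n‖ ≤ (1.42 * ρ) * ‖z - x‖ := by
      exact le_trans (mul_le_mul_of_nonneg_right (by linarith) (norm_nonneg n)) (h3.trans h5)
    have h7 : 40 * ‖n‖ ≤ 1.42 * ‖z - x‖ := by
      refine le_of_mul_le_mul_left ?_ hρ
      linarith
    linarith [norm_nonneg (P z)]
  intro y₀ hy₀
  -- Let `R` be the radius of the largest open ball covered by `K`, and `y` an uncovered point just
  -- beyond it. If `P z` is the point of `K` closest to `y`, then `y - P z` and its negative are
  -- normal to `M` at `z`. But `M` also has points projecting to both sides of the origin in this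
  -- direction, close to `z`, which contradicts the exclusion balls unless `τ` is comparable to `R <
  -- ρ`.
  by_contra hy₀K
  rw [mem_ball_zero_iff] at hy₀
  set S : Set ℝ := norm '' Kᶜ with hS
  have hSne : S.Nonempty := ⟨_, y₀, hy₀K, rfl⟩
  have hSbdd : BddBelow S := ⟨0, by rintro _ ⟨y, -, rfl⟩; exact norm_nonneg y⟩
  set R := sInf S with hR
  have hcov : ∀ y : T, ‖y‖ < R → y ∈ K := by
    intro y hy
    by_contra hyK
    exact absurd (csInf_le hSbdd ⟨y, hyK, rfl⟩) (not_le.2 hy)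
  have hRρ : R < ρ := (csInf_le hSbdd ⟨y₀, hy₀K, rfl⟩).trans_lt hy₀
  have hRpos : 0 < R := by
    obtain ⟨κ, hκ, hball⟩ := Metric.mem_nhds_iff.1 (hnhds _ (closedBall_mem_nhds x hrpos))
    refine hκ.trans_le (le_csInf hSne ?_)
    rintro _ ⟨y, hy, rfl⟩
    by_contra hcon
    exact hy (hball (by rw [mem_ball_zero_iff]; linarith))
  obtain ⟨_, ⟨y, hyK, rfl⟩, hyR⟩ := exists_lt_of_csInf_lt hSne
    (show sInf S < min ρ (1.01 * R) from lt_min hRρ (by linarith))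
  have hyR' : ‖y‖ < 1.01 * R := hyR.trans_le (min_le_right _ _)
  obtain ⟨z, ⟨hzM, hzr⟩, hzmin⟩ :=
    ((isCompact_closedBall x r).inter_left hM.isClosed).exists_isMinOn ⟨x, hx, mem_closedBall_self hrpos.le⟩ (f := fun z => ‖y - P z‖ ^ 2) (by fun_prop)
  have hzmin' : ∀ k ∈ K, ‖y - P z‖ ≤ ‖y - k‖ := by
    rintro _ ⟨z', hz', rfl⟩
    exact (pow_le_pow_iff_left₀ (norm_nonneg _) (norm_nonneg _) two_ne_zero).1 (hzmin hz')
  have hPz : ‖P z‖ ≤ 1.05 * R := by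
    -- Since `0.98 * 1.01 < 1`, this shrunk point is covered, so `P z` is within `0.02 * ‖y‖` of
    -- `y`.
    have h1 : ((0.98 : ℝ) • y) ∈ K := hcov _ (by
      rw [norm_smul, Real.norm_of_nonneg (by norm_num)]; linarith)
    have h2 := hzmin' _ h1
    have h3 : y - (0.98 : ℝ) • y = (0.02 : ℝ) • y := by
      rw [← one_smul ℝ y, smul_smul, ← sub_smul]; norm_num
    rw [h3, norm_smul, Real.norm_of_nonneg (by norm_num)] at h2
    have h4 := norm_sub_norm_le (P z) y
    rw [norm_sub_rev] at h4
    linarith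
  rw [mem_closedBall, dist_eq_norm] at hzr
  have hzx := hheight z hzM hzr
  -- `1.04 * 1.05 < 1.41`: the minimizer is interior to the ball, hence a local minimum on all of
  -- `M`.
  have hzlt : ‖z - x‖ < r := by linarith
  -- the direction from `P z` to `y` is normal at `z`
  obtain ⟨T', -, hn', -, hmin'⟩ := hM.exists_tangent hτ hzM
  set w : T := y - P z with hw
  have hwne : w ≠ 0 := by
    intro h0
    rw [hw, sub_eq_zero] at h0
    exact hyK ⟨z, ⟨hzM, by rw [mem_closedBall, dist_eq_norm]; exact hzr⟩, h0.symm⟩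
  have hwpos : 0 < ‖w‖ := norm_pos_iff.2 hwne
  have hinner : ∀ v, inner ℝ (w : EuclideanSpace ℝ (Fin D)) v
      = inner ℝ w (T.orthogonalProjectionOnto v) := fun v =>
    (T.inner_orthogonalProjectionOnto_eq_of_mem_left w v).symm
  have hwT' : ∀ v ∈ T', inner ℝ (w : EuclideanSpace ℝ (Fin D)) v = 0 := by
    intro v hv
    have hder : HasFDerivAt (fun z => ‖y - P z‖ ^ 2)
        (2 • (innerSL ℝ w).comp (-T.orthogonalProjectionOnto)) z := by
      have h1 : HasFDerivAt (fun z => y - P z) (-T.orthogonalProjectionOnto) z :=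
        (T.orthogonalProjectionOnto.hasFDerivAt.comp z
          ((hasFDerivAt_id z).sub_const x)).const_sub y
      exact h1.norm_sq
    have hloc : IsLocalMinOn (fun z => ‖y - P z‖ ^ 2) M z := by
      have h1 : closedBall x r ∈ 𝓝[M] z := nhdsWithin_le_nhds
        (mem_of_superset (isOpen_ball.mem_nhds (by rw [mem_ball, dist_eq_norm]; exact hzlt))
          ball_subset_closedBall)
      filter_upwards [h1, self_mem_nhdsWithin] with z' hz' hz'M
      exact hzmin ⟨hz'M, hz'⟩
    have h2 := hmin' _ _ hder hloc v hv
    rw [hinner]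
    simpa using h2
  -- The constant `1.7` exceeds `1.04 / 2 + 1.04 * 1.05`.
  have htest : ∀ c : ℝ, |c| = R / 2 / ‖w‖ → ∃ z' ∈ M, P z' = c • w ∧ ‖z' - z‖ ≤ 1.7 * R := by
    intro c hc
    have hnc : ‖c • w‖ = R / 2 := by
      rw [norm_smul, Real.norm_eq_abs, hc, div_mul_cancel₀ _ hwpos.ne']
    obtain ⟨z', ⟨hz', hz'r⟩, hz'P⟩ := hcov (c • w) (by rw [hnc]; linarith)
    rw [mem_closedBall, dist_eq_norm] at hz'r
    refine ⟨z', hz', hz'P, ?_⟩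
    have h1 := hheight z' hz' hz'r
    rw [hz'P, hnc] at h1
    have h2 : ‖z' - z‖ ≤ ‖z' - x‖ + ‖z - x‖ := by
      rw [← dist_eq_norm, ← dist_eq_norm, ← dist_eq_norm]; exact dist_triangle_right _ _ _
    linarith
  have hc0 : 0 ≤ R / 2 / ‖w‖ := by positivity
  obtain ⟨z₁, hz₁, hz₁P, hz₁z⟩ := htest (R / 2 / ‖w‖) (abs_of_nonneg hc0)
  obtain ⟨z₂, hz₂, hz₂P, hz₂z⟩ := htest (-(R / 2 / ‖w‖)) (by rw [abs_neg, abs_of_nonneg hc0])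
  have e1 := hn' w hwT' z₁ hz₁
  have e2 := hn' (-w) (fun v hv => by rw [inner_neg_left, hwT' v hv, neg_zero]) z₂ hz₂
  -- Using both signs of `w` eliminates the unknown position of `z`.
  have e3 : inner ℝ (w : EuclideanSpace ℝ (Fin D)) (z₁ - z) +
      inner ℝ (-w : EuclideanSpace ℝ (Fin D)) (z₂ - z)
      = R * ‖w‖ := by
    rw [inner_neg_left, ← sub_eq_add_neg, ← inner_sub_right, sub_sub_sub_cancel_right]
    have h1 : z₁ - z₂ = (z₁ - x) - (z₂ - x) := by abel
    rw [hinner, h1, map_sub]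
    change inner ℝ w (P z₁ - P z₂) = _
    rw [hz₁P, hz₂P, ← sub_smul, inner_smul_right, real_inner_self_eq_norm_sq]
    field_simp
    ring
  rw [norm_neg] at e2
  have hwn : ‖(w : EuclideanSpace ℝ (Fin D))‖ = ‖w‖ := rfl
  rw [hwn] at e1 e2
  have e4 : 2 * τ * (R * ‖w‖) ≤ ‖w‖ * ((1.7 * R) ^ 2 + (1.7 * R) ^ 2) := by
    have h1 : ‖z₁ - z‖ ^ 2 ≤ (1.7 * R) ^ 2 := by gcongr
    have h2 : ‖z₂ - z‖ ^ 2 ≤ (1.7 * R) ^ 2 := by gcongr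
    rw [← e3, mul_add]
    nlinarith
  have e5 : 2 * τ ≤ 2 * 1.7 ^ 2 * R := by
    refine le_of_mul_le_mul_right ?_ (mul_pos hRpos hwpos)
    linarith
  linarith

open Measure in
/-- Near its maximum in the direction `b`, the manifold is at least as large as a ball. -/
lemma IsModelManifold.volume_cap_ge (hM : IsModelManifold d V τ M) (hτ : 0 < τ)
    (b : EuclideanSpace ℝ (Fin D)) (hb : ‖b‖ = 1) {δ : ℝ} (hδ : 0 < δ) (hδ' : 20 * √δ ≤ 1) :
    ENNReal.ofReal ((√δ * τ) ^ d * unitBallVolume d) ≤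
      μHE[d] (M ∩ {x | supportFunction M b - δ * τ ≤ inner ℝ b x}) := by
  obtain ⟨x, hx, hmax⟩ := hM.isCompact.exists_isMaxOn hM.nonempty
    (f := fun z => inner ℝ b z) (by fun_prop)
  have hs : supportFunction M b = inner ℝ b x := by
    refine IsGreatest.csSup_eq ⟨⟨x, hx, rfl⟩, ?_⟩
    rintro _ ⟨z, hz, rfl⟩
    exact hmax hz
  set ρ := √δ * τ with hρ
  have hδs : 0 < √δ := Real.sqrt_pos.2 hδ
  have hρpos : 0 < ρ := by positivity
  obtain ⟨T, hT, hball⟩ := ball_subset_image_orthogonalProjectionOnto hM hτ hx hρpos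
    (by rw [hρ]; nlinarith)
  -- Within radius `√2 ρ` the depth is at most `2ρ² / (2τ) = δτ`.
  have hsub : M ∩ closedBall x (√2 * ρ) ⊆ M ∩ {x | supportFunction M b - δ * τ ≤ inner ℝ b x} := by
    rintro z ⟨hz, hzr⟩
    refine ⟨hz, ?_⟩
    have h1 := hM.two_mul_inner_sub_le hτ hx (fun z hz => hmax hz) hz
    rw [mem_closedBall, dist_eq_norm] at hzr
    have h2 : ‖z - x‖ ^ 2 ≤ (√2 * ρ) ^ 2 := by gcongr
    rw [mul_pow, Real.sq_sqrt (by norm_num), hρ, mul_pow, Real.sq_sqrt hδ.le] at h2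
    rw [hb, one_mul, inner_sub_right] at h1
    have h3 : inner ℝ b x - inner ℝ b z ≤ δ * τ := by
      refine le_of_mul_le_mul_left ?_ (show 0 < 2 * τ by positivity)
      linarith
    simp only [mem_ofPred_eq, hs]
    linarith
  have hlip : LipschitzWith 1 fun z => T.orthogonalProjectionOnto (z - x) := by
    refine LipschitzWith.of_dist_le_mul fun z z' => ?_
    rw [dist_eq_norm, dist_eq_norm, ← map_sub, sub_sub_sub_cancel_right, NNReal.coe_one, one_mul]
    exact T.norm_orthogonalProjectionOnto_apply_le _
  have hvolT : (μHE[d] : Measure T) (ball 0 ρ) = ENNReal.ofReal (ρ ^ d * unitBallVolume d) := by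
    have e1 : (μHE[d] : Measure T) (ball 0 ρ) =
        (μHE[d] : Measure (EuclideanSpace ℝ (Fin d))) (ball 0 ρ) := by
      let e : T ≃ₗᵢ[ℝ] EuclideanSpace ℝ (Fin d) :=
        (stdOrthonormalBasis ℝ T).reindex (finCongr hT) |>.repr
      rw [← e.isometry.euclideanHausdorffMeasure_image, e.image_ball, map_zero]
    rw [e1, EuclideanSpace.euclideanHausdorffMeasure_eq_volume,
      Measure.addHaar_ball_of_pos _ _ hρpos, ENNReal.ofReal_mul (by positivity),
      finrank_euclideanSpace, Fintype.card_fin, unitBallVolume, ENNReal.ofReal_toReal measure_ball_lt_top.ne]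
  rw [← hvolT]
  calc (μHE[d] : Measure T) (ball 0 ρ)
      ≤ μHE[d] ((fun z => T.orthogonalProjectionOnto (z - x)) '' (M ∩ closedBall x (√2 * ρ))) :=
        measure_mono hball
    _ ≤ μHE[d] (M ∩ closedBall x (√2 * ρ)) := by
        rw [euclideanHausdorffMeasure_def, euclideanHausdorffMeasure_def, Measure.smul_apply,
          Measure.smul_apply]
        have := hlip.hausdorffMeasure_image_le (d := d) (Nat.cast_nonneg d)
          (M ∩ closedBall x (√2 * ρ))
        simp only [ENNReal.coe_one, ENNReal.one_rpow, one_mul] at this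
        gcongr
    _ ≤ _ := measure_mono hsub

end Cap

/-! ### Values and operation counts of the algorithm -/

section Algorithm

namespace Counted

variable {α β : Type}

@[simp] lemma pure_val (a : α) : (pure a : Counted α).val = a := rfl
@[simp] lemma pure_ops (a : α) : (pure a : Counted α).ops = 0 := rfl
@[simp] lemma bind_val (x : Counted α) (f : α → Counted β) : (x >>= f).val = (f x.val).val := rfl
@[simp] lemma bind_ops (x : Counted α) (f : α → Counted β) :
    (x >>= f).ops = x.ops + (f x.val).ops := rfl
@[simp] lemma op_val (a : α) : (op a).val = a := rfl
@[simp] lemma op_ops (a : α) : (op a).ops = 1 := rfl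

lemma foldlM_val (f : β → α → Counted β) (l : List α) (b : β) :
    (l.foldlM f b).val = l.foldl (fun acc a => (f acc a).val) b := by
  induction l generalizing b with
  | nil => rfl
  | cons a l ih => rw [List.foldlM_cons, bind_val, ih, List.foldl_cons]

lemma foldlM_ops_le {f : β → α → Counted β} {c : ℕ} (hf : ∀ b a, (f b a).ops ≤ c) (l : List α)
    (b : β) : (l.foldlM f b).ops ≤ l.length * c := by
  induction l generalizing b with
  | nil => simp
  | cons a l ih =>
    rw [List.foldlM_cons, bind_ops, List.length_cons, add_mul, one_mul, add_comm]
    exact add_le_add (ih _) (hf _ _)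

lemma pow_val (x : ℝ) (n : ℕ) : (pow x n).val = x ^ n := by
  induction n with
  | zero => simp [pow]
  | succ n ih => simp [pow, mul, ih, pow_succ]

lemma pow_ops (x : ℝ) (n : ℕ) : (pow x n).ops = n := by
  induction n with
  | zero => rfl
  | succ n ih => simp [pow, mul, ih]

lemma foldl_add_eq_sum {n : ℕ} (f : Fin n → ℝ) (a : ℝ) :
    (List.finRange n).foldl (fun acc k => acc + f k) a = a + ∑ k, f k := by
  have h : ∀ (l : List (Fin n)) (a : ℝ),
      l.foldl (fun acc k => acc + f k) a = a + (l.map f).sum := by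
    intro l
    induction l with
    | nil => simp
    | cons k l ih => intro a; rw [List.foldl_cons, ih, List.map_cons, List.sum_cons, add_assoc]
  rw [h, ← List.ofFn_eq_map, List.sum_ofFn]

lemma dot_val {D : ℕ} (x b : EuclideanSpace ℝ (Fin D)) : (dot x b).val = inner ℝ b x := by
  simp only [dot, foldlM_val, mul, add, bind_val, op_val]
  rw [foldl_add_eq_sum, zero_add, PiLp.inner_apply]
  rfl

lemma dot_ops_le {D : ℕ} (x b : EuclideanSpace ℝ (Fin D)) : (dot x b).ops ≤ D * 2 := by
  have := foldlM_ops_le (c := 2) (f := fun (acc : ℝ) k => do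
    let t ← mul (x k) (b k)
    add acc t) (fun _ _ => le_rfl) (List.finRange D) 0
  rwa [List.length_finRange] at this

end Counted

open Counted

variable {D N : ℕ} (X : Fin N → EuclideanSpace ℝ (Fin D)) (b : EuclideanSpace ℝ (Fin D))
  (δ Γ : ℝ)

lemma slabDensity_val (j : ℤ) :
    (slabDensity X b δ j).val =
      (∑ i, (Set.Ioc (j * δ) ((j + 1) * δ)).indicator (fun _ => (1 : ℝ)) (inner ℝ b (X i)))
        / (N * δ) := by
  let step : ℝ → Fin N → Counted ℝ := fun acc i => do
    let t ← dot (X i) b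
    let above ← lt (j * δ) t
    let below ← le t (((j + 1 : ℤ) : ℝ) * δ)
    if above && below then add acc 1 else pure acc
  have hstep : (fun acc i => (step acc i).val) = fun acc i =>
      acc + (Set.Ioc (j * δ) ((j + 1) * δ)).indicator (fun _ => (1 : ℝ)) (inner ℝ b (X i)) := by
    funext acc i
    have h1 : (step acc i).val = (if (decide (j * δ < (dot (X i) b).val) &&
      decide ((dot (X i) b).val ≤ ((j + 1 : ℤ) : ℝ) * δ)) = true then add acc 1
      else pure acc : Counted ℝ).val := rfl
    rw [h1, dot_val, Set.indicator_apply]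
    simp only [Bool.and_eq_true, decide_eq_true_eq, Set.mem_Ioc]
    push_cast
    split_ifs
    · rfl
    · simp
  have h2 : (slabDensity X b δ j).val = ((List.finRange N).foldlM step 0).val / (N * δ) := rfl
  rw [h2, foldlM_val, hstep, foldl_add_eq_sum, zero_add]

lemma slabDensity_ops_le (j : ℤ) : (slabDensity X b δ j).ops ≤ N * (D * 2 + 3) + 5 := by
  let step : ℝ → Fin N → Counted ℝ := fun acc i => do
    let t ← dot (X i) b
    let above ← lt (j * δ) t
    let below ← le t (((j + 1 : ℤ) : ℝ) * δ)
    if above && below then add acc 1 else pure acc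
  have hstep : ∀ acc i, (step acc i).ops ≤ D * 2 + 3 := by
    intro acc i
    have h1 : (step acc i).ops = (dot (X i) b).ops + (1 + (1 + (if
      (decide (j * δ < (dot (X i) b).val) &&
      decide ((dot (X i) b).val ≤ ((j + 1 : ℤ) : ℝ) * δ)) = true then add acc 1
      else pure acc : Counted ℝ).ops)) := rfl
    have h2 : ∀ c : Bool, (if c = true then add acc 1 else pure acc : Counted ℝ).ops ≤ 1 := by
      intro c
      cases c
      · exact Nat.zero_le 1
      · exact le_rfl
    have h3 := dot_ops_le (X i) b
    have h4 := h2 (decide (j * δ < (dot (X i) b).val) &&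
      decide ((dot (X i) b).val ≤ ((j + 1 : ℤ) : ℝ) * δ))
    rw [h1]
    omega
  have h := foldlM_ops_le hstep (List.finRange N) 0
  rw [List.length_finRange] at h
  have h2 : (slabDensity X b δ j).ops =
    1 + (1 + (1 + (((List.finRange N).foldlM step 0).ops + (1 + 1)))) := rfl
  omega

/-- One index known to pass the test excludes failure. The scan may stop before it, so only the test
at the stopping index survives as information. -/
lemma scan_val (jmax i : ℤ) : ∀ (passes : ℕ) (j₀ : ℤ), j₀ < i → i ≤ jmax → i ≤ j₀ + passes →
    (slabDensity X b δ i).val ≤ Γ →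
    ∃ j, (scan X b δ Γ jmax passes j₀).val = some j ∧ j₀ < j ∧ j ≤ i ∧
      (slabDensity X b δ j).val ≤ Γ
  | 0, j₀, h1, _, h3, _ => by push_cast at h3; omega
  | passes + 1, j₀, h1, h2, h3, h4 => by
    simp only [scan, intAdd, le, intEq, bind_val, op_val, decide_eq_true_eq]
    by_cases hhit : (slabDensity X b δ (j₀ + 1)).val ≤ Γ
    · exact ⟨j₀ + 1, by simp [hhit], by omega, by omega, hhit⟩
    · have hne : j₀ + 1 ≠ i := by rintro rfl; exact hhit h4
      obtain ⟨j, hj, hj1, hj2, hj3⟩ := scan_val jmax i passes (j₀ + 1) (by omega) h2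
        (by push_cast at h3; omega) h4
      refine ⟨j, ?_, by omega, hj2, hj3⟩
      have hlast : j₀ + 1 ≠ jmax := by omega
      rw [if_neg hhit, bind_val]
      simpa [op_val, hlast] using hj

/-- The 8 is 5 operations of `slabDensity` outside its sample loop plus the increment and the two
tests. -/
lemma scan_ops_le (jmax : ℤ) : ∀ (passes : ℕ) (j₀ : ℤ),
    (scan X b δ Γ jmax passes j₀).ops ≤ passes * (N * (D * 2 + 3) + 8)
  | 0, j₀ => by simp [scan]
  | passes + 1, j₀ => by
    have h1 := slabDensity_ops_le X b δ (j₀ + 1)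
    have h2 := scan_ops_le jmax passes (j₀ + 1)
    have h3 : (scan X b δ Γ jmax (passes + 1) j₀).ops = 1 + ((slabDensity X b δ (j₀ + 1)).ops +
      (1 + (if decide ((slabDensity X b δ (j₀ + 1)).val ≤ Γ) = true then pure (some (j₀ + 1))
        else (do
          let last ← intEq (j₀ + 1) jmax
          if last then pure none else scan X b δ Γ jmax passes (j₀ + 1)) :
            Counted (Option ℤ)).ops)) := rfl
    rw [h3, add_mul, one_mul]
    have h4 : (if decide (j₀ + 1 = jmax) = true then pure none
        else scan X b δ Γ jmax passes (j₀ + 1) : Counted (Option ℤ)).ops ≤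
          passes * (N * (D * 2 + 3) + 8) := by
      split_ifs
      · exact Nat.zero_le _
      · exact h2
    have h5 : (if decide ((slabDensity X b δ (j₀ + 1)).val ≤ Γ) = true then pure (some (j₀ + 1))
        else (do
          let last ← intEq (j₀ + 1) jmax
          if last then pure none else scan X b δ Γ jmax passes (j₀ + 1)) :
            Counted (Option ℤ)).ops ≤ 1 + passes * (N * (D * 2 + 3) + 8) := by
      split_ifs
      · exact Nat.zero_le _
      · exact Nat.add_le_add_left h4 1
    omega

/-- The ratio `V / ((√δ τ)^d ω_d)`. -/
noncomputable def volumeRatio (d : ℕ) (V τ δ : ℝ) : ℝ := V / ((√δ * τ) ^ d * unitBallVolume d)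

/-- The offset `r_δ`. -/
noncomputable def offset (d : ℕ) (V τ σ δ : ℝ) : ℝ :=
  σ ^ 2 / (δ * τ) * Real.log (volumeRatio d V τ δ)

/-- The threshold `Γ_δ`. -/
noncomputable def threshold (d : ℕ) (V τ σ δ : ℝ) : ℝ :=
  (√δ * τ) ^ d * unitBallVolume d / V / (√(2 * Real.pi) * σ) *
    Real.exp (-1 / 2 * (σ / (δ * τ) * Real.log (volumeRatio d V τ δ)) ^ 2)

/-- The first index `j_-` of the loop. -/
noncomputable def firstIndex (d : ℕ) (V τ σ δ : ℝ) : ℤ :=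
  ⌊(offset d V τ σ δ - 1 - δ * τ) / δ⌋ - 1

/-- The last index `j_+` of the loop. -/
noncomputable def lastIndex (d : ℕ) (V τ σ δ : ℝ) : ℤ :=
  ⌊(offset d V τ σ δ + 1 + δ * τ) / δ⌋ + 1

variable (d : ℕ) (V τ σ ε : ℝ)

lemma findDistance_val_of_scan {j : ℤ}
    (h : (scan X b (ε / 16) (threshold d V τ σ (ε / 16)) (lastIndex d V τ σ (ε / 16))
      (lastIndex d V τ σ (ε / 16) - firstIndex d V τ σ (ε / 16)).toNat
      (firstIndex d V τ σ (ε / 16))).val = some j) :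
    (findDistance d V τ σ ε b X).val = some (j * (ε / 16) - offset d V τ σ (ε / 16)) := by
  simp only [threshold, lastIndex, firstIndex, offset, volumeRatio] at h ⊢
  simp only [findDistance, div, Counted.sqrt, mul, log, Counted.exp, sub, add, Counted.floor,
    intAdd, bind_val, op_val, pow_val, ← pow_two, ← sub_eq_add_neg, h]
  rfl

lemma findDistance_ops_le :
    (findDistance d V τ σ ε b X).ops ≤ d + 33 +
      (lastIndex d V τ σ (ε / 16) - firstIndex d V τ σ (ε / 16)).toNat *
        (N * (D * 2 + 3) + 8) := by
  have h := scan_ops_le X b (ε / 16) (threshold d V τ σ (ε / 16)) (lastIndex d V τ σ (ε / 16))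
    (lastIndex d V τ σ (ε / 16) - firstIndex d V τ σ (ε / 16)).toNat
    (firstIndex d V τ σ (ε / 16))
  simp only [threshold, lastIndex, firstIndex, offset, volumeRatio] at h ⊢
  simp only [findDistance, div, Counted.sqrt, mul, log, Counted.exp, sub, add, Counted.floor,
    intAdd, bind_ops, op_val, op_ops, pow_val, pow_ops, ← pow_two, ← sub_eq_add_neg]
  -- Outside the scan there are `d` operations for the power and at most 31 others, so 33 leaves
  -- slack.
  refine le_trans (b := d + 33 + (scan X b (ε / 16) _ _ _ _).ops) ?_ (Nat.add_le_add_left h _)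
  clear h
  generalize scan X b (ε / 16) _ _ _ _ = S
  obtain ⟨o, n⟩ := S
  cases o <;> simp only [bind_ops, op_ops, pure_ops] <;> omega

end Algorithm

/-! ### The law of the projected samples -/

section Projection

open Set

variable {D d : ℕ} {V τ σ : ℝ} {M : Set (EuclideanSpace ℝ (Fin D))}

lemma map_inner_multivariateGaussian (σ : ℝ) (b : EuclideanSpace ℝ (Fin D)) (hb : ‖b‖ = 1) :
    (multivariateGaussian 0 ((σ ^ 2) • (1 : Matrix (Fin D) (Fin D) ℝ))).map (innerSL ℝ b) =
      gaussianReal 0 (σ ^ 2).toNNReal := by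
  have hS : ((σ ^ 2) • (1 : Matrix (Fin D) (Fin D) ℝ)).PosSemidef :=
    Matrix.PosSemidef.one.smul (sq_nonneg σ)
  rw [IsGaussian.map_eq_gaussianReal,
    (innerSL ℝ b).integral_comp_comm (φ := fun x => x) IsGaussian.integrable_fun_id,
    integral_id_multivariateGaussian, map_zero]
  congr 2
  have h1 := covarianceBilin_self (μ := multivariateGaussian 0 ((σ ^ 2) •
    (1 : Matrix (Fin D) (Fin D) ℝ))) IsGaussian.memLp_two_id b
  rw [covarianceBilin_multivariateGaussian hS] at h1
  rw [show Var[innerSL ℝ b; multivariateGaussian 0 ((σ ^ 2) • (1 : Matrix (Fin D) (Fin D) ℝ))] =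
    Var[fun u ↦ inner ℝ b u; multivariateGaussian 0 ((σ ^ 2) • (1 : Matrix (Fin D) (Fin D) ℝ))]
    from rfl, ← h1, Matrix.smul_mulVec, Matrix.one_mulVec, dotProduct_smul]
  have h2 : (b.ofLp ⬝ᵥ b.ofLp) = 1 := by
    have h3 := real_inner_self_eq_norm_sq b
    rw [hb, PiLp.inner_apply] at h3
    simpa [dotProduct, pow_two] using h3
  rw [h2, smul_eq_mul, mul_one]

/-- Integrate over the noise first: given the point `x` of `M`, the projected sample is Gaussian
with centre `b · x`. -/
lemma noisyLaw_inner_apply (b : EuclideanSpace ℝ (Fin D)) (hb : ‖b‖ = 1) {S : Set ℝ}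
    (hS : MeasurableSet S) :
    noisyLaw d σ M {x | inner ℝ b x ∈ S} =
      ∫⁻ x, gaussianReal (inner ℝ b x) (σ ^ 2).toNNReal S ∂(ProbabilityTheory.cond (μHE[d]) M) := by
  have hL : Measurable (innerSL ℝ b) := by fun_prop
  have hS' : MeasurableSet {x | inner ℝ b x ∈ S} := hL hS
  rw [← lintegral_indicator_one hS', noisyLaw,
    Measure.lintegral_conv (measurable_one.indicator hS')]
  refine lintegral_congr fun x => ?_
  have hSx : MeasurableSet ((inner ℝ b x + ·) ⁻¹' S) := measurable_const_add _ hS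
  conv_rhs => rw [← zero_add (inner ℝ b x), ← gaussianReal_map_const_add,
    Measure.map_apply (by fun_prop) hS, ← map_inner_multivariateGaussian σ b hb,
    Measure.map_apply hL hSx, ← lintegral_indicator_one (hL hSx)]
  refine lintegral_congr fun y => ?_
  have : x + y ∈ {x | inner ℝ b x ∈ S} ↔ y ∈ innerSL ℝ b ⁻¹' ((inner ℝ b x + ·) ⁻¹' S) := by
    simp [inner_add_right]
  by_cases h : x + y ∈ {x | inner ℝ b x ∈ S}
  · rw [Set.indicator_of_mem h, Set.indicator_of_mem (this.1 h)]; rfl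
  · rw [Set.indicator_of_notMem h, Set.indicator_of_notMem (mt this.2 h)]

lemma gaussianReal_Ioc_le {c a b K : ℝ} {v : ℝ≥0} (hv : v ≠ 0)
    (h : ∀ x ∈ Ioc a b, gaussianPDFReal c v x ≤ K) :
    gaussianReal c v (Ioc a b) ≤ ENNReal.ofReal K * ENNReal.ofReal (b - a) := by
  rw [gaussianReal_apply c hv]
  refine (setLIntegral_mono measurable_const fun x hx => ENNReal.ofReal_le_ofReal (h x hx)).trans ?_
  rw [setLIntegral_const, Real.volume_Ioc]

lemma le_gaussianReal_Ioc {c a b K : ℝ} {v : ℝ≥0} (hv : v ≠ 0)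
    (h : ∀ x ∈ Ioc a b, K ≤ gaussianPDFReal c v x) :
    ENNReal.ofReal K * ENNReal.ofReal (b - a) ≤ gaussianReal c v (Ioc a b) := by
  rw [gaussianReal_apply c hv]
  refine le_trans ?_ (setLIntegral_mono (measurable_gaussianPDF c v)
    fun x hx => ENNReal.ofReal_le_ofReal (h x hx))
  rw [setLIntegral_const, Real.volume_Ioc]

end Projection

/-! ### Concentration of the empirical slab frequencies -/

section Concentration

lemma integral_indicator_comp {Ω E : Type*} [MeasurableSpace Ω] [MeasurableSpace E]
    {P : Measure Ω} {μ : Measure E} {Y : Ω → E} (hY : HasLaw Y μ P)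
    {S : Set E} (hS : MeasurableSet S) :
    ∫ ω, S.indicator (fun _ => (1 : ℝ)) (Y ω) ∂P = μ.real S := by
  have h := hY.integral_comp (f := S.indicator fun _ => (1 : ℝ))
    ((measurable_const.indicator hS).aestronglyMeasurable)
  rw [← integral_indicator_one hS]
  exact h

variable {Ω : Type*} [MeasurableSpace Ω] {P : Measure Ω} [IsProbabilityMeasure P]

/-- Hoeffding's inequality. The left endpoint `a` is free so that negated indicators, with `a = -1`,
yield the lower tail. -/
lemma measure_sum_ge_le {N : ℕ} {Z : Fin N → Ω → ℝ} (hZ : iIndepFun Z P)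
    (hm : ∀ i, AEMeasurable (Z i) P) {a m t : ℝ} (hb : ∀ i ω, Z i ω ∈ Set.Icc a (a + 1))
    (hE : ∀ i, ∫ ω, Z i ω ∂P ≤ m) (ht : 0 ≤ t) :
    P.real {ω | N * (m + t) ≤ ∑ i, Z i ω} ≤ Real.exp (-2 * N * t ^ 2) := by
  have h1 : iIndepFun (fun i ω => Z i ω - ∫ ω, Z i ω ∂P) P :=
    hZ.comp (fun i x => x - ∫ ω, Z i ω ∂P) fun i => by fun_prop
  have h2 := HasSubgaussianMGF.measure_sum_ge_le_of_iIndepFun h1 (s := Finset.univ)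
    (c := fun _ => (‖(a + 1) - a‖₊ / 2) ^ 2)
    (fun i _ => hasSubgaussianMGF_of_mem_Icc (hm i) (ae_of_all _ (hb i)))
    (ε := N * t) (by positivity)
  refine (measureReal_mono ?_ (measure_ne_top _ _)).trans (h2.trans ?_)
  · intro ω hω
    simp only [Set.mem_ofPred_eq, Finset.sum_sub_distrib] at hω ⊢
    have h3 : ∑ i, ∫ ω, Z i ω ∂P ≤ N * m := by
      refine (Finset.sum_le_sum fun i _ => hE i).trans ?_
      simp
    linarith
  · rw [Real.exp_le_exp]
    rcases Nat.eq_zero_or_pos N with rfl | hN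
    · simp
    · have hN' : (0 : ℝ) < N := by exact_mod_cast hN
      simp only [add_sub_cancel_left, nnnorm_one, Finset.sum_const, Finset.card_univ,
        Fintype.card_fin, nsmul_eq_mul]
      push_cast
      refine le_of_eq ?_
      field_simp

variable {E : Type*} [MeasurableSpace E] {N : ℕ} {X : Fin N → Ω → E} {μ : Measure E}

/-- The empirical frequency of an event is unlikely to exceed its probability by `t`. -/
lemma measure_frequency_ge_le (hX : iIndepFun X P) (hL : ∀ i, HasLaw (X i) μ P) {S : Set E}
    (hS : MeasurableSet S) {q t : ℝ} (ht : 0 ≤ t) (hq : μ.real S + t ≤ q) :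
    P.real {ω | N * q < ∑ i, S.indicator (fun _ => (1 : ℝ)) (X i ω)} ≤
      Real.exp (-2 * N * t ^ 2) := by
  have hmeas : Measurable (S.indicator fun _ => (1 : ℝ)) := measurable_const.indicator hS
  refine le_trans (measureReal_mono ?_ (measure_ne_top _ _))
    (measure_sum_ge_le (a := 0) (m := μ.real S) (hX.comp (fun _ => S.indicator fun _ => (1 : ℝ))
      fun _ => hmeas) (fun i => hmeas.comp_aemeasurable (hL i).aemeasurable) ?_ ?_ ht)
  · intro ω hω
    simp only [Set.mem_ofPred_eq, Function.comp_apply] at hω ⊢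
    refine le_trans ?_ hω.le
    gcongr
  · intro i ω
    by_cases h : X i ω ∈ S <;> simp [h]
  · exact fun i => (integral_indicator_comp (hL i) hS).le

/-- The empirical frequency of an event is unlikely to fall short of its probability by `t`. -/
lemma measure_frequency_le_le (hX : iIndepFun X P) (hL : ∀ i, HasLaw (X i) μ P) {S : Set E}
    (hS : MeasurableSet S) {q t : ℝ} (ht : 0 ≤ t) (hq : q + t ≤ μ.real S) :
    P.real {ω | ∑ i, S.indicator (fun _ => (1 : ℝ)) (X i ω) ≤ N * q} ≤
      Real.exp (-2 * N * t ^ 2) := by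
  have hmeas : Measurable (fun x => -S.indicator (fun _ => (1 : ℝ)) x) :=
    (measurable_const.indicator hS).neg
  refine le_trans (measureReal_mono ?_ (measure_ne_top _ _))
    (measure_sum_ge_le (a := -1) (m := -μ.real S)
      (hX.comp (fun _ x => -S.indicator (fun _ => (1 : ℝ)) x) fun _ => hmeas) (fun i => hmeas.comp_aemeasurable (hL i).aemeasurable) ?_ ?_ ht)
  · intro ω hω
    simp only [Set.mem_ofPred_eq, Function.comp_apply, Finset.sum_neg_distrib] at hω ⊢
    rw [le_neg]
    refine hω.trans ?_
    rw [← mul_neg]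
    gcongr
    linarith
  · intro i ω
    by_cases h : X i ω ∈ S <;> simp [h]
  · intro i
    simp only [Function.comp_apply]
    rw [integral_neg, integral_indicator_comp (hL i) hS]

end Concentration

/-! ### The probability of a slab -/

section Slab

open Set

variable {D d : ℕ} {V τ σ δ : ℝ} {M : Set (EuclideanSpace ℝ (Fin D))}

lemma unitBallVolume_pos (d : ℕ) : 0 < unitBallVolume d :=
  ENNReal.toReal_pos (Metric.measure_ball_pos _ _ one_pos).ne' measure_ball_lt_top.ne

lemma volumeRatio_pos (d : ℕ) (hV : 0 < V) (hτ : 0 < τ) (hδ : 0 < δ) :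
    0 < volumeRatio d V τ δ := by
  have := unitBallVolume_pos d
  unfold volumeRatio
  positivity

lemma gaussianPDFReal_eq (hσ : 0 < σ) (c x : ℝ) :
    gaussianPDFReal c (σ ^ 2).toNNReal x =
      (√(2 * Real.pi) * σ)⁻¹ * Real.exp (-(x - c) ^ 2 / (2 * σ ^ 2)) := by
  rw [gaussianPDFReal, Real.coe_toNNReal _ (sq_nonneg σ), Real.sqrt_mul (by positivity),
    Real.sqrt_sq hσ.le]

/-- Exhibits the threshold as the Gaussian density at distance `r` divided by `R`, the form used in
all comparisons. -/
lemma threshold_eq (d : ℕ) (V τ : ℝ) (hσ : 0 < σ) (δ : ℝ) :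
    threshold d V τ σ δ = (volumeRatio d V τ δ)⁻¹ * (√(2 * Real.pi) * σ)⁻¹ *
      Real.exp (-(offset d V τ σ δ) ^ 2 / (2 * σ ^ 2)) := by
  unfold threshold offset
  rw [volumeRatio, inv_div, div_eq_mul_inv _ (√(2 * Real.pi) * σ)]
  congr 2
  field_simp

lemma threshold_pos (d : ℕ) (hV : 0 < V) (hτ : 0 < τ) (hσ : 0 < σ) (hδ : 0 < δ) :
    0 < threshold d V τ σ δ := by
  rw [threshold_eq d V τ hσ]
  have := volumeRatio_pos d hV hτ hδ
  positivity

lemma offset_mul (d : ℕ) (V : ℝ) (hτ : 0 < τ) (hσ : 0 < σ) (hδ : 0 < δ) :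
    offset d V τ σ δ * (δ * τ) / σ ^ 2 = Real.log (volumeRatio d V τ δ) := by
  unfold offset
  field_simp

/-- Above the level `c + r_δ + δτ` the Gaussian density is below the threshold. -/
lemma gaussianPDFReal_le_threshold (hV : 0 < V) (hτ : 0 < τ) (hσ : 0 < σ) (hδ : 0 < δ)
    (hL : 0 ≤ Real.log (volumeRatio d V τ δ)) {c x u : ℝ} (hu : 0 ≤ u)
    (hx : c + offset d V τ σ δ + δ * τ + u * δ ≤ x) :
    gaussianPDFReal c (σ ^ 2).toNNReal x ≤
      threshold d V τ σ δ * Real.exp (-(Real.log (volumeRatio d V τ δ) * u / τ)) := by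
  have hR := volumeRatio_pos d hV hτ hδ
  have hoff := offset_mul d V hτ hσ hδ
  rw [threshold_eq d V τ hσ, gaussianPDFReal_eq hσ]
  set L := Real.log (volumeRatio d V τ δ) with hLdef
  set r := offset d V τ σ δ with hr
  have hr0 : 0 ≤ r := by rw [hr, offset]; positivity
  have hRexp : (volumeRatio d V τ δ)⁻¹ = Real.exp (-L) := by
    rw [hLdef, Real.exp_neg, Real.exp_log hR]
  rw [hRexp, show ∀ p q s t : ℝ, p * q * s * t = q * (s * p * t) by intros; ring,
    ← Real.exp_add, ← Real.exp_add]
  refine mul_le_mul_of_nonneg_left (Real.exp_le_exp.2 ?_) (by positivity)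
  rw [div_eq_iff (by positivity)] at hoff
  have h1 : L * u / τ = r * (u * δ) / σ ^ 2 := by
    rw [div_eq_div_iff (by positivity) (by positivity)]
    linear_combination (-u) * hoff
  have h2 : L = r * (δ * τ) / σ ^ 2 := by rw [hoff]; field_simp
  rw [h1, h2]
  have h3 : (r + (δ * τ + u * δ)) ^ 2 ≤ (x - c) ^ 2 := by
    have : 0 ≤ δ * τ + u * δ := by positivity
    refine pow_le_pow_left₀ (by positivity) (by linarith) 2
  have h4 : -r ^ 2 / (2 * σ ^ 2) + -(r * (δ * τ) / σ ^ 2) + -(r * (u * δ) / σ ^ 2) =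
      (-r ^ 2 - 2 * r * (δ * τ + u * δ)) / (2 * σ ^ 2) := by
    field_simp
    ring
  rw [h4]
  gcongr
  nlinarith [sq_nonneg (δ * τ + u * δ)]

lemma exp_two_ge_four : 4 ≤ Real.exp 2 := by
  have h1 := Real.add_one_le_exp (1 : ℝ)
  have h2 : Real.exp 2 = Real.exp 1 * Real.exp 1 := by rw [← Real.exp_add]; norm_num
  rw [h2]; nlinarith

/-- On the first quarter of the slab the density is at most `Γ`, on the rest at most `Γ / 4` because
`exp 2 ≥ 4`; altogether `7/16 < 1/2` of `δΓ`. -/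
lemma gaussianReal_upper_slab_le (hV : 0 < V) (hτ : 0 < τ) (hσ : 0 < σ) (hδ : 0 < δ)
    (hL : 8 * τ ≤ Real.log (volumeRatio d V τ δ)) {c a : ℝ}
    (ha : c + offset d V τ σ δ + δ * τ ≤ a) :
    gaussianReal c (σ ^ 2).toNNReal (Ioc a (a + δ)) ≤
      ENNReal.ofReal (δ * threshold d V τ σ δ / 2) := by
  have hv : (σ ^ 2).toNNReal ≠ 0 := (Real.toNNReal_pos.2 (by positivity)).ne'
  have hΓ := threshold_pos d hV hτ hσ hδ
  have hL0 : 0 ≤ Real.log (volumeRatio d V τ δ) := by linarith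
  have h1 : gaussianReal c (σ ^ 2).toNNReal (Ioc a (a + δ / 4)) ≤
      ENNReal.ofReal (threshold d V τ σ δ) * ENNReal.ofReal (a + δ / 4 - a) := by
    refine gaussianReal_Ioc_le hv fun x hx => ?_
    have := gaussianPDFReal_le_threshold hV hτ hσ hδ hL0 le_rfl (c := c) (x := x)
      (by linarith [hx.1])
    simpa using this
  have h2 : gaussianReal c (σ ^ 2).toNNReal (Ioc (a + δ / 4) (a + δ)) ≤
      ENNReal.ofReal (threshold d V τ σ δ / 4) * ENNReal.ofReal (a + δ - (a + δ / 4)) := by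
    refine gaussianReal_Ioc_le hv fun x hx => ?_
    refine (gaussianPDFReal_le_threshold hV hτ hσ hδ hL0 (u := 1 / 4) (by norm_num)
      (by linarith [hx.1])).trans ?_
    rw [div_eq_mul_inv (threshold d V τ σ δ)]
    refine mul_le_mul_of_nonneg_left ?_ hΓ.le
    rw [Real.exp_neg]
    refine inv_anti₀ (by norm_num) (exp_two_ge_four.trans (Real.exp_le_exp.2 ?_))
    rw [le_div_iff₀ hτ]
    linarith
  rw [← Ioc_union_Ioc_eq_Ioc (show a ≤ a + δ / 4 by linarith) (show a + δ / 4 ≤ a + δ by linarith)]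
  refine (measure_union_le _ _).trans ((add_le_add h1 h2).trans ?_)
  rw [← ENNReal.ofReal_mul hΓ.le, ← ENNReal.ofReal_mul (by positivity),
    ← ENNReal.ofReal_add (by ring_nf; positivity) (by ring_nf; positivity)]
  refine ENNReal.ofReal_le_ofReal ?_
  nlinarith [mul_pos hδ hΓ]

/-- For a centre in the cap, the whole slab lies within `r - δ`. Being `δ` closer than `r` gains a
factor `exp (r * δ / (2 * σ ^ 2)) ≥ 2`. The bound `ha` stops the slab from being too far on the
inner side. -/
lemma le_gaussianReal_lower_slab (hV : 0 < V) (hτ : 0 < τ) (hσ : 0 < σ) (hδ : 0 < δ)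
    (hL : 8 * τ ≤ Real.log (volumeRatio d V τ δ)) (hδr : δ ≤ offset d V τ σ δ) {s c a : ℝ}
    (hc : s - δ * τ ≤ c) (hc' : c ≤ s) (ha : s - offset d V τ σ δ + δ ≤ a)
    (ha' : a + δ ≤ s + offset d V τ σ δ - δ * τ - δ) :
    ENNReal.ofReal (volumeRatio d V τ δ * (2 * δ * threshold d V τ σ δ)) ≤
      gaussianReal c (σ ^ 2).toNNReal (Ioc a (a + δ)) := by
  have hv : (σ ^ 2).toNNReal ≠ 0 := (Real.toNNReal_pos.2 (by positivity)).ne'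
  have hR := volumeRatio_pos d hV hτ hδ
  have hΓ := threshold_pos d hV hτ hσ hδ
  refine le_trans ?_ (le_gaussianReal_Ioc (K := 2 * (volumeRatio d V τ δ * threshold d V τ σ δ))
    hv fun x hx => ?_)
  · rw [← ENNReal.ofReal_mul (by positivity)]
    exact ENNReal.ofReal_le_ofReal (le_of_eq (by ring))
  · rw [gaussianPDFReal_eq hσ, threshold_eq d V τ hσ, mul_assoc _⁻¹, mul_inv_cancel_left₀ hR.ne',
      mul_left_comm]
    refine mul_le_mul_of_nonneg_left ?_ (by positivity)
    have hoff := offset_mul d V hτ hσ hδ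
    set L := Real.log (volumeRatio d V τ δ) with hLdef
    set r := offset d V τ σ δ with hr
    have h1 : (x - c) ^ 2 ≤ (r - δ) ^ 2 :=
      sq_le_sq' (by linarith [hx.1]) (by linarith [hx.2])
    have h2 : 1 ≤ r * δ / (2 * σ ^ 2) := by
      rw [le_div_iff₀ (by positivity)]
      rw [div_eq_iff (by positivity)] at hoff
      refine le_of_mul_le_mul_right ?_ hτ
      have : 8 * τ * σ ^ 2 ≤ L * σ ^ 2 := by gcongr
      nlinarith [mul_pos hτ (pow_pos hσ 2)]
    have h3 : (2 : ℝ) ≤ Real.exp 1 := by have := Real.add_one_le_exp (1 : ℝ); linarith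
    calc 2 * Real.exp (-r ^ 2 / (2 * σ ^ 2))
        ≤ Real.exp 1 * Real.exp (-r ^ 2 / (2 * σ ^ 2)) := by gcongr
      _ = Real.exp (1 + -r ^ 2 / (2 * σ ^ 2)) := (Real.exp_add _ _).symm
      _ ≤ _ := by
        refine Real.exp_le_exp.2 ?_
        calc 1 + -r ^ 2 / (2 * σ ^ 2) ≤ r * δ / (2 * σ ^ 2) + -r ^ 2 / (2 * σ ^ 2) := by gcongr
          _ = (r * δ - r ^ 2) / (2 * σ ^ 2) := by ring
          _ ≤ _ := by
            gcongr
            nlinarith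

lemma IsModelManifold.volume_ne_top (hM : IsModelManifold d V τ M) : μHE[d] M ≠ ⊤ :=
  (hM.volume_le.trans_lt ENNReal.ofReal_lt_top).ne

lemma IsModelManifold.cond_cap_ge (hM : IsModelManifold d V τ M) (hV : 0 < V) (hτ : 0 < τ)
    {b : EuclideanSpace ℝ (Fin D)} (hb : ‖b‖ = 1) (hδ : 0 < δ) (hδ' : 20 * √δ ≤ 1) :
    ENNReal.ofReal (volumeRatio d V τ δ)⁻¹ ≤ ProbabilityTheory.cond (μHE[d]) M
      {x | supportFunction M b - δ * τ ≤ inner ℝ b x} := by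
  have h := hM.volume_cap_ge hτ b hb hδ hδ'
  rw [cond_apply hM.isClosed.measurableSet, volumeRatio, inv_div, div_eq_inv_mul,
    ENNReal.ofReal_mul (by positivity), ENNReal.ofReal_inv_of_pos hV]
  gcongr
  exact hM.volume_le

/-- Any admissible cap already has positive volume; `δ = 1/400` is the extreme case of `20 * √δ ≤
1`. -/
lemma IsModelManifold.volume_ne_zero (hM : IsModelManifold d V τ M) (hτ : 0 < τ)
    {b : EuclideanSpace ℝ (Fin D)} (hb : ‖b‖ = 1) : μHE[d] M ≠ 0 := by
  intro h0
  have h := hM.volume_cap_ge hτ b hb (δ := 1 / 400) (by norm_num) (by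
    rw [show (1 / 400 : ℝ) = (1 / 20) ^ 2 by norm_num, Real.sqrt_sq (by norm_num)]; norm_num)
  have h1 := h.trans (measure_mono inter_subset_left)
  rw [h0, nonpos_iff_eq_zero, ENNReal.ofReal_eq_zero] at h1
  have := unitBallVolume_pos d
  have : 0 < (√(1 / 400 : ℝ) * τ) ^ d * unitBallVolume d := by positivity
  linarith

lemma IsModelManifold.isProbabilityMeasure_cond (hM : IsModelManifold d V τ M)
    (hτ : 0 < τ) {b : EuclideanSpace ℝ (Fin D)} (hb : ‖b‖ = 1) :
    IsProbabilityMeasure (ProbabilityTheory.cond (μHE[d]) M) :=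
  cond_isProbabilityMeasure_of_finite (hM.volume_ne_zero hτ hb) hM.volume_ne_top

lemma IsModelManifold.inner_le_supportFunction (hM : IsModelManifold d V τ M)
    (b : EuclideanSpace ℝ (Fin D)) {x : EuclideanSpace ℝ (Fin D)} (hx : x ∈ M) :
    inner ℝ b x ≤ supportFunction M b :=
  le_csSup (hM.isCompact.image (by fun_prop)).bddAbove ⟨x, hx, rfl⟩

lemma IsModelManifold.abs_supportFunction_le (hM : IsModelManifold d V τ M)
    {b : EuclideanSpace ℝ (Fin D)} (hb : ‖b‖ = 1) : |supportFunction M b| ≤ 1 := by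
  have h1 : ∀ x ∈ M, |inner ℝ b x| ≤ 1 := fun x hx => by
    have h2 := hM.subset_ball hx
    rw [mem_closedBall_zero_iff] at h2
    have h3 := abs_real_inner_le_norm b x
    rw [hb, one_mul] at h3
    exact h3.trans h2
  obtain ⟨y, hy⟩ := hM.nonempty
  refine abs_le.2 ⟨(abs_le.1 (h1 y hy)).1.trans (hM.inner_le_supportFunction b hy), ?_⟩
  refine csSup_le (hM.nonempty.image _) ?_
  rintro _ ⟨x, hx, rfl⟩
  exact (abs_le.1 (h1 x hx)).2

/-- Slabs sufficiently far outside carry less than half of the threshold mass. -/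
lemma IsModelManifold.noisyLaw_upper_slab_le (hM : IsModelManifold d V τ M) (hV : 0 < V)
    (hτ : 0 < τ) (hσ : 0 < σ) (hδ : 0 < δ) (hL : 8 * τ ≤ Real.log (volumeRatio d V τ δ))
    {b : EuclideanSpace ℝ (Fin D)} (hb : ‖b‖ = 1) {a : ℝ}
    (ha : supportFunction M b + offset d V τ σ δ + δ * τ ≤ a) :
    (noisyLaw d σ M).real {x | inner ℝ b x ∈ Ioc a (a + δ)} ≤ δ * threshold d V τ σ δ / 2 := by
  have := hM.isProbabilityMeasure_cond hτ hb
  have hΓ := threshold_pos d hV hτ hσ hδ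
  refine ENNReal.toReal_le_of_le_ofReal (by positivity) ?_
  rw [noisyLaw_inner_apply b hb measurableSet_Ioc]
  calc _ ≤ ∫⁻ _, ENNReal.ofReal (δ * threshold d V τ σ δ / 2)
        ∂(ProbabilityTheory.cond (μHE[d]) M) := by
        refine lintegral_mono_ae ?_
        filter_upwards [ae_cond_mem hM.isClosed.measurableSet] with x hx
        have := hM.inner_le_supportFunction b hx
        exact gaussianReal_upper_slab_le hV hτ hσ hδ hL (by linarith)
    _ = _ := by simp

/-- Slabs further inside carry more than twice the threshold mass. -/
lemma IsModelManifold.le_noisyLaw_lower_slab (hM : IsModelManifold d V τ M) (hV : 0 < V)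
    (hτ : 0 < τ) (hσ : 0 < σ) (hδ : 0 < δ) (hδ' : 20 * √δ ≤ 1)
    (hL : 8 * τ ≤ Real.log (volumeRatio d V τ δ)) (hδr : δ ≤ offset d V τ σ δ)
    {b : EuclideanSpace ℝ (Fin D)} (hb : ‖b‖ = 1) {a : ℝ}
    (ha : supportFunction M b - offset d V τ σ δ + δ ≤ a)
    (ha' : a + δ ≤ supportFunction M b + offset d V τ σ δ - δ * τ - δ) :
    2 * δ * threshold d V τ σ δ ≤ (noisyLaw d σ M).real {x | inner ℝ b x ∈ Ioc a (a + δ)} := by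
  have := hM.isProbabilityMeasure_cond hτ hb
  have : IsProbabilityMeasure (noisyLaw d σ M) := by unfold noisyLaw; infer_instance
  have hR := volumeRatio_pos d hV hτ hδ
  have hΓ := threshold_pos d hV hτ hσ hδ
  rw [measureReal_def, ← ENNReal.ofReal_le_iff_le_toReal (measure_ne_top _ _),
    noisyLaw_inner_apply b hb measurableSet_Ioc]
  set cap : Set (EuclideanSpace ℝ (Fin D)) := {x | supportFunction M b - δ * τ ≤ inner ℝ b x}
  have hcap : MeasurableSet cap :=
    (isClosed_le continuous_const (by fun_prop)).measurableSet
  calc ENNReal.ofReal (2 * δ * threshold d V τ σ δ)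
      = ENNReal.ofReal (volumeRatio d V τ δ * (2 * δ * threshold d V τ σ δ)) *
          ENNReal.ofReal (volumeRatio d V τ δ)⁻¹ := by
        rw [← ENNReal.ofReal_mul (by positivity)]
        congr 1
        field_simp
    _ ≤ ENNReal.ofReal (volumeRatio d V τ δ * (2 * δ * threshold d V τ σ δ)) *
          ProbabilityTheory.cond (μHE[d]) M cap := by
        gcongr
        exact hM.cond_cap_ge hV hτ hb hδ hδ'
    _ = ∫⁻ _ in cap, ENNReal.ofReal (volumeRatio d V τ δ * (2 * δ * threshold d V τ σ δ))
          ∂(ProbabilityTheory.cond (μHE[d]) M) := (setLIntegral_const _ _).symm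
    _ ≤ ∫⁻ x in cap, gaussianReal (inner ℝ b x) (σ ^ 2).toNNReal (Ioc a (a + δ))
          ∂(ProbabilityTheory.cond (μHE[d]) M) := by
        refine lintegral_mono_ae ?_
        filter_upwards [ae_restrict_of_ae (ae_cond_mem hM.isClosed.measurableSet),
          ae_restrict_mem hcap] with x hx hxc
        exact le_gaussianReal_lower_slab hV hτ hσ hδ hL hδr hxc
          (hM.inner_le_supportFunction b hx) ha ha'
    _ ≤ _ := setLIntegral_le_lintegral _ _

end Slab

/-! ### Small `δ` and the number of samples -/

section Asymptotics

open Filter Topology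

lemma tendsto_volumeRatio {d : ℕ} (hd : 1 ≤ d) {V τ : ℝ} (hV : 0 < V) (hτ : 0 < τ) :
    Tendsto (volumeRatio d V τ) (𝓝[>] 0) atTop := by
  unfold volumeRatio
  simp only [div_eq_mul_inv]
  refine Tendsto.const_mul_atTop hV (tendsto_inv_nhdsGT_zero.comp ?_)
  refine tendsto_nhdsWithin_iff.2 ⟨?_, ?_⟩
  · have hc : Continuous fun δ : ℝ => (√δ * τ) ^ d * unitBallVolume d := by fun_prop
    have h := hc.tendsto 0
    rw [Real.sqrt_zero, zero_mul, zero_pow (by omega), zero_mul] at h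
    exact h.mono_left nhdsWithin_le_nhds
  · filter_upwards [self_mem_nhdsWithin] with δ hδ
    have := unitBallVolume_pos d
    have : 0 < √δ := Real.sqrt_pos.2 hδ
    exact Set.mem_Ioi.2 (by positivity)

/-- Since `R → ∞` as `δ → 0`, all smallness conditions hold together. The one with `5 * τ` gives `r
≥ 5`; the one with `K` makes the sample number exceed the number of passes and the dimensions. -/
lemma exists_small_scale {d : ℕ} (hd : 1 ≤ d) {V τ σ : ℝ} (hV : 0 < V) (hτ : 0 < τ)
    (hσ : 0 < σ) (K : ℝ) :
    ∃ δ₀ > 0, ∀ δ, 0 < δ → δ < δ₀ → 20 * √δ ≤ 1 ∧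
      8 * τ ≤ Real.log (volumeRatio d V τ δ) ∧
      5 * τ ≤ σ ^ 2 * Real.log (volumeRatio d V τ δ) ∧ 2 * δ ≤ σ ∧
      K ≤ σ ^ 2 * volumeRatio d V τ δ := by
  have hR := tendsto_volumeRatio hd hV hτ
  have hL := Real.tendsto_log_atTop.comp hR
  have h1 : ∀ᶠ δ in 𝓝[>] (0 : ℝ), 20 * √δ ≤ 1 := by
    have hc : Continuous fun δ : ℝ => 20 * √δ := by fun_prop
    have h := hc.tendsto 0
    rw [Real.sqrt_zero, mul_zero] at h
    exact (h.mono_left nhdsWithin_le_nhds).eventually_le_const one_pos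
  have h4 : ∀ᶠ δ in 𝓝[>] (0 : ℝ), 2 * δ ≤ σ := by
    have hc : Continuous fun δ : ℝ => 2 * δ := by fun_prop
    have h := hc.tendsto 0
    rw [mul_zero] at h
    exact (h.mono_left nhdsWithin_le_nhds).eventually_le_const hσ
  have h := h1.and ((hL.eventually_ge_atTop (8 * τ)).and
    (((hL.const_mul_atTop (pow_pos hσ 2)).eventually_ge_atTop (5 * τ)).and
      (h4.and ((hR.const_mul_atTop (pow_pos hσ 2)).eventually_ge_atTop K))))
  obtain ⟨δ₀, hδ₀, hsub⟩ := mem_nhdsGT_iff_exists_Ioo_subset.1 h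
  exact ⟨δ₀, hδ₀, fun δ hδ hlt => hsub ⟨hδ, hlt⟩⟩

lemma sampleBound_eq (d : ℕ) (V τ σ : ℝ) {ε : ℝ} (η : ℝ) :
    sampleBound d V τ σ ε η =
      (3 * 2 ^ 10 * √(2 * Real.pi) * (σ ^ 2 / (ε / 16) ^ 2 * volumeRatio d V τ (ε / 16))) ^ 3 *
        Real.exp ((σ / (ε / 16 * τ) * Real.log (volumeRatio d V τ (ε / 16))) ^ 2) *
          Real.log η⁻¹ := by
  have h1 : √ε * τ / 4 = √(ε / 16) * τ := by
    rw [Real.sqrt_div' _ (by norm_num), show (16 : ℝ) = 4 ^ 2 by norm_num,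
      Real.sqrt_sq (by norm_num)]
    ring
  simp only [sampleBound, volumeRatio, h1]
  rw [show ε * τ / 16 = ε / 16 * τ by ring]
  congr 3
  ring

lemma half_le_log_inv {η : ℝ} (hη : 0 < η) (hη' : η < 1 / 2) : 1 / 2 ≤ Real.log η⁻¹ := by
  have h1 : Real.log 2 ≤ Real.log η⁻¹ := by
    refine Real.log_le_log (by norm_num) ?_
    rw [le_inv_comm₀ (by norm_num) hη]
    linarith
  have := Real.log_two_gt_d9
  linarith

lemma two_le_sqrt_two_pi : 2 ≤ √(2 * Real.pi) :=
  Real.le_sqrt_of_sq_le (by nlinarith [Real.pi_gt_three])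

variable {d N : ℕ} {V τ σ ε η K : ℝ}

lemma le_sampleRate (hε : 0 < ε) (hε1 : ε / 16 ≤ 1) (hK : 2 ≤ K)
    (hB : K ≤ σ ^ 2 * volumeRatio d V τ (ε / 16)) :
    2 / (ε / 16) + (K - 2) ≤ σ ^ 2 / (ε / 16) ^ 2 * volumeRatio d V τ (ε / 16) := by
  set δ := ε / 16 with hδdef
  have hδ : 0 < δ := by positivity
  have h1 : 1 ≤ 1 / δ := (one_le_div hδ).2 hε1
  have h2 : 1 / δ ^ 2 = 1 / δ * (1 / δ) := by rw [pow_two]; field_simp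
  calc 2 / δ + (K - 2) = 2 * (1 / δ) + (K - 2) * 1 := by ring
    _ ≤ 2 * (1 / δ ^ 2) + (K - 2) * (1 / δ ^ 2) := by
        have h3 : 1 / δ ≤ 1 / δ ^ 2 := by rw [h2]; nlinarith
        gcongr
        linarith
    _ = K * (1 / δ ^ 2) := by ring
    _ ≤ (σ ^ 2 * volumeRatio d V τ δ) * (1 / δ ^ 2) := by gcongr
    _ = _ := by ring

lemma le_of_sampleBound_le (hη : 0 < η) (hη' : η < 1 / 2)
    (hB : 1 ≤ σ ^ 2 / (ε / 16) ^ 2 * volumeRatio d V τ (ε / 16))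
    (hN : sampleBound d V τ σ ε η ≤ N) :
    σ ^ 2 / (ε / 16) ^ 2 * volumeRatio d V τ (ε / 16) ≤ N := by
  refine le_trans ?_ hN
  rw [sampleBound_eq]
  set B := σ ^ 2 / (ε / 16) ^ 2 * volumeRatio d V τ (ε / 16)
  have h1 := two_le_sqrt_two_pi
  have h2 := half_le_log_inv hη hη'
  have h3 : 2 * B ≤ 3 * 2 ^ 10 * √(2 * Real.pi) * B := by
    gcongr
    nlinarith
  have h4 : 2 * B ≤ (3 * 2 ^ 10 * √(2 * Real.pi) * B) ^ 3 :=
    h3.trans (le_self_pow₀ (by linarith) (by norm_num))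
  calc B = (2 * B) * 1 * (1 / 2) := by ring
    _ ≤ _ := by
      gcongr
      exact Real.one_le_exp (sq_nonneg _)

/-- The number of samples makes the failure probability of the Hoeffding bound, summed over the
passes of the loop, smaller than `η`. -/
lemma mul_exp_lt_of_sampleBound_le (hV : 0 < V) (hτ : 0 < τ) (hσ : 0 < σ) (hε : 0 < ε)
    (hη : 0 < η) (hη' : η < 1 / 2) (hδσ : 2 * (ε / 16) ≤ σ) {n : ℝ} (hn : 0 ≤ n)
    (hB : n + 1 ≤ σ ^ 2 / (ε / 16) ^ 2 * volumeRatio d V τ (ε / 16))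
    (hN : sampleBound d V τ σ ε η ≤ N) :
    n * Real.exp (-2 * N * (ε / 16 * threshold d V τ σ (ε / 16) / 2) ^ 2) < η := by
  set δ := ε / 16 with hδdef
  have hδ : 0 < δ := by positivity
  have hℓ := half_le_log_inv hη hη'
  have hR := volumeRatio_pos d hV hτ hδ
  rw [sampleBound_eq, ← hδdef] at hN
  have hΓ : threshold d V τ σ δ ^ 2 = (volumeRatio d V τ δ)⁻¹ ^ 2 * (2 * Real.pi * σ ^ 2)⁻¹ *
      (Real.exp ((σ / (δ * τ) * Real.log (volumeRatio d V τ δ)) ^ 2))⁻¹ := by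
    rw [threshold_eq d V τ hσ, mul_pow, mul_pow, inv_pow (√(2 * Real.pi) * σ), mul_pow,
      Real.sq_sqrt (by positivity), ← Real.exp_nat_mul, ← Real.exp_neg]
    congr 2
    rw [offset]
    push_cast
    field_simp
  set R := volumeRatio d V τ δ with hRdef
  set B := σ ^ 2 / δ ^ 2 * R with hBdef
  set Q := Real.exp ((σ / (δ * τ) * Real.log R) ^ 2) with hQdef
  have hQ : 0 < Q := Real.exp_pos _
  have hBpos : 0 < B := by positivity
  set C := 3 * 2 ^ 10 * √(2 * Real.pi) with hC
  have hC1 : 6144 ≤ C := by rw [hC]; linarith [two_le_sqrt_two_pi]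
  -- The factor `Q` cancels the exponential in `Γ²`, and two of the three powers of `B` absorb the
  -- remaining negative powers, leaving one `B` for the union bound.
  have hexp : 4 * B * Real.log η⁻¹ ≤ 2 * N * (δ * threshold d V τ σ δ / 2) ^ 2 := by
    have e1 : 2 * ((C * B) ^ 3 * Q * Real.log η⁻¹) * (δ * threshold d V τ σ δ / 2) ^ 2 =
        (C ^ 3 / (4 * Real.pi)) * (σ ^ 2 / δ ^ 2) * B * Real.log η⁻¹ := by
      rw [div_pow, mul_pow δ, hΓ, hBdef]
      field_simp
      ring
    have e2 : 4 ≤ σ ^ 2 / δ ^ 2 := by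
      rw [le_div_iff₀ (by positivity)]
      nlinarith
    have e3 : 1 ≤ C ^ 3 / (4 * Real.pi) := by
      rw [le_div_iff₀ (by positivity), one_mul]
      have : C ≤ C ^ 3 := le_self_pow₀ (by linarith) (by norm_num)
      linarith [Real.pi_le_four]
    calc 4 * B * Real.log η⁻¹ = 1 * 4 * B * Real.log η⁻¹ := by ring
      _ ≤ (C ^ 3 / (4 * Real.pi)) * (σ ^ 2 / δ ^ 2) * B * Real.log η⁻¹ := by gcongr
      _ = _ := e1.symm
      _ ≤ _ := by gcongr
  have h1 : Real.exp (-2 * N * (δ * threshold d V τ σ δ / 2) ^ 2) ≤ η * Real.exp (-(2 * n)) := by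
    have h2 : η = Real.exp (-Real.log η⁻¹) := by
      rw [Real.log_inv, neg_neg, Real.exp_log hη]
    rw [h2, ← Real.exp_add, Real.exp_le_exp]
    -- Split `4B log η⁻¹` into one `log η⁻¹`, which yields `η`, and the rest, which is at least `2n`
    -- and beats the factor `n`.
    have h3 : (4 * B - 1) * (1 / 2) ≤ (4 * B - 1) * Real.log η⁻¹ := by
      refine mul_le_mul_of_nonneg_left hℓ (by linarith)
    linarith
  have h4 : n * Real.exp (-(2 * n)) < 1 := by
    rw [Real.exp_neg, ← div_eq_mul_inv, div_lt_one (Real.exp_pos _)]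
    have := Real.add_one_le_exp (2 * n)
    linarith
  calc n * Real.exp (-2 * N * (δ * threshold d V τ σ δ / 2) ^ 2)
      ≤ n * (η * Real.exp (-(2 * n))) := by gcongr
    _ = η * (n * Real.exp (-(2 * n))) := by ring
    _ < η * 1 := by gcongr
    _ = η := mul_one η

/-- The 3 collects one unit of floor rounding and the two unit shifts in the definitions of the
indices. -/
lemma passes_le (d : ℕ) (V σ : ℝ) {τ δ : ℝ} (hτ : 0 < τ) (hδ : 0 < δ) :
    ((lastIndex d V τ σ δ - firstIndex d V τ σ δ).toNat : ℝ) ≤ 2 / δ + 2 * τ + 3 := by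
  rcases le_total 0 (lastIndex d V τ σ δ - firstIndex d V τ σ δ) with h | h
  · have h1 : ((lastIndex d V τ σ δ - firstIndex d V τ σ δ).toNat : ℝ) =
        ((lastIndex d V τ σ δ - firstIndex d V τ σ δ : ℤ) : ℝ) := by
      exact_mod_cast congrArg (Int.cast (R := ℝ)) (Int.toNat_of_nonneg h)
    rw [h1, lastIndex, firstIndex]
    set r := offset d V τ σ δ
    push_cast
    have h2 := Int.floor_le ((r + 1 + δ * τ) / δ)
    have h3 := Int.lt_floor_add_one ((r - 1 - δ * τ) / δ)
    have h4 : (r + 1 + δ * τ) / δ - (r - 1 - δ * τ) / δ = 2 / δ + 2 * τ := by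
      field_simp
      ring
    linarith
  · rw [Int.toNat_of_nonpos h]
    push_cast
    positivity

end Asymptotics

/-! ### Correctness of the algorithm -/

section Correctness

open Set

variable {D d N : ℕ} {V τ σ ε : ℝ}

lemma slabDensity_le_iff (hN : 0 < N) {δ : ℝ} (hδ : 0 < δ) (b : EuclideanSpace ℝ (Fin D))
    (x : Fin N → EuclideanSpace ℝ (Fin D)) (Γ : ℝ) (j : ℤ) :
    (slabDensity x b δ j).val ≤ Γ ↔
      ∑ i, {y | inner ℝ b y ∈ Ioc (j * δ) (j * δ + δ)}.indicator (fun _ => (1 : ℝ)) (x i) ≤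
        N * (δ * Γ) := by
  have hN' : (0 : ℝ) < N := by exact_mod_cast hN
  rw [slabDensity_val, div_le_iff₀ (by positivity), add_mul, one_mul,
    show Γ * (N * δ) = N * (δ * Γ) by ring]
  rfl

/-- If the empirical densities are on the right side of the threshold for the slabs sufficiently
far inside and sufficiently far outside, then the output is close to the support function. -/
lemma findDistance_val_close (hτ : 0 < τ) (hτ1 : τ ≤ 1) (hε : 0 < ε) {s : ℝ} (hs : |s| ≤ 1)
    (b : EuclideanSpace ℝ (Fin D)) (x : Fin N → EuclideanSpace ℝ (Fin D))
    (hhigh : ∀ j : ℤ, firstIndex d V τ σ (ε / 16) < j → j ≤ lastIndex d V τ σ (ε / 16) →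
      s + offset d V τ σ (ε / 16) + ε / 16 * τ ≤ j * (ε / 16) →
      (slabDensity x b (ε / 16) j).val ≤ threshold d V τ σ (ε / 16))
    (hlow : ∀ j : ℤ, firstIndex d V τ σ (ε / 16) < j → j ≤ lastIndex d V τ σ (ε / 16) →
      j * (ε / 16) + ε / 16 ≤ s + offset d V τ σ (ε / 16) - ε / 16 * τ - ε / 16 →
      ¬(slabDensity x b (ε / 16) j).val ≤ threshold d V τ σ (ε / 16)) :
    ∃ t, (findDistance d V τ σ ε b x).val = some t ∧ |t - s| < ε := by
  set δ := ε / 16 with hδdef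
  have hδ : 0 < δ := by positivity
  set r := offset d V τ σ δ with hr
  obtain ⟨hs1, hs2⟩ := abs_le.1 hs
  have hδτ : δ * τ ≤ δ := by nlinarith
  have hδτ0 : 0 < δ * τ := by positivity
  -- The first slab far enough outside; it stops the loop at the latest.
  set i : ℤ := ⌈(s + r + δ * τ) / δ⌉ with hi
  have hi1 : s + r + δ * τ ≤ i * δ := (div_le_iff₀ hδ).1 (Int.le_ceil _)
  have hi2 : i * δ < s + r + δ * τ + δ := by
    have := Int.ceil_lt_add_one ((s + r + δ * τ) / δ)
    rw [← hi, ← sub_lt_iff_lt_add, lt_div_iff₀ hδ] at this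
    linarith
  have hfirst : (firstIndex d V τ σ δ : ℝ) * δ ≤ r - 1 - δ * τ - δ := by
    rw [firstIndex]
    push_cast
    have := (le_div_iff₀ hδ).1 (Int.floor_le ((r - 1 - δ * τ) / δ))
    linarith
  have hlt : firstIndex d V τ σ δ < i := by
    have : (firstIndex d V τ σ δ : ℝ) * δ < i * δ := by linarith
    exact_mod_cast lt_of_mul_lt_mul_right this hδ.le
  have hle : i ≤ lastIndex d V τ σ δ := by
    rw [lastIndex]
    refine Int.ceil_le.2 ?_
    push_cast
    refine le_trans ?_ (Int.lt_floor_add_one _).le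
    exact div_le_div_of_nonneg_right (by linarith) hδ.le
  obtain ⟨j, hj, hj1, hj2, hj3⟩ := scan_val x b δ (threshold d V τ σ δ) (lastIndex d V τ σ δ) i
    (lastIndex d V τ σ δ - firstIndex d V τ σ δ).toNat (firstIndex d V τ σ δ) hlt hle
    (by have := Int.self_le_toNat (lastIndex d V τ σ δ - firstIndex d V τ σ δ); linarith)
    (hhigh i hlt hle hi1)
  refine ⟨_, findDistance_val_of_scan x b d V τ σ ε hj, ?_⟩
  rw [← hδdef, ← hr]
  have h1 : (j : ℝ) * δ ≤ i * δ := by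
    refine mul_le_mul_of_nonneg_right ?_ hδ.le
    exact_mod_cast hj2
  have h2 : s + r - δ * τ - δ < j * δ + δ := by
    by_contra hcon
    exact hlow j hj1 (hj2.trans hle) (not_lt.1 hcon) hj3
  -- The error lies between `-3δ` and `2δ` because `τ ≤ 1`, well within `ε = 16δ`.
  rw [abs_lt]
  constructor <;> linarith

/-- Failure requires some slab to have its empirical frequency on the wrong side of `δΓ`, a
deviation of at least `δΓ / 2`. Slabs in the transition zone cannot cause failure, so the union
bound costs only the number of passes. -/
lemma IsModelManifold.findDistance_correct {M : Set (EuclideanSpace ℝ (Fin D))}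
    (hM : IsModelManifold d V τ M) (hd : 1 ≤ d) (hV : 0 < V) (hτ : 0 < τ) (hσ : 0 < σ)
    (hε : 0 < ε) (hN : 0 < N) (hδ' : 20 * √(ε / 16) ≤ 1)
    (hL : 8 * τ ≤ Real.log (volumeRatio d V τ (ε / 16)))
    (hr5 : 5 ≤ offset d V τ σ (ε / 16)) (hδ1 : ε / 16 ≤ 1)
    {b : EuclideanSpace ℝ (Fin D)} (hb : ‖b‖ = 1) {Ω : Type*} [MeasurableSpace Ω] (P : Measure Ω)
    [IsProbabilityMeasure P] (X : Fin N → Ω → EuclideanSpace ℝ (Fin D)) (hX : iIndepFun X P)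
    (hlaw : ∀ i, HasLaw (X i) (noisyLaw d σ M) P) :
    1 - (lastIndex d V τ σ (ε / 16) - firstIndex d V τ σ (ε / 16)).toNat *
        Real.exp (-2 * N * (ε / 16 * threshold d V τ σ (ε / 16) / 2) ^ 2) ≤
      P.real {ω | ∃ s : ℝ, (findDistance d V τ σ ε b (fun i => X i ω)).val = some s ∧
        |s - supportFunction M b| < ε} := by
  have hτ1 := hM.tau_le_one hd hτ
  have hs := hM.abs_supportFunction_le hb
  obtain ⟨hs1, hs2⟩ := abs_le.1 hs
  set δ := ε / 16 with hδdef
  have hδ : 0 < δ := by positivity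
  have hδτ : δ * τ ≤ 1 := by nlinarith
  set s := supportFunction M b with hsdef
  set r := offset d V τ σ δ with hr
  set Γ := threshold d V τ σ δ with hΓdef
  have hΓ : 0 < Γ := threshold_pos d hV hτ hσ hδ
  set S : ℤ → Set (EuclideanSpace ℝ (Fin D)) :=
    fun j => {y | inner ℝ b y ∈ Ioc ((j : ℝ) * δ) (j * δ + δ)} with hS
  have hSm : ∀ j, MeasurableSet (S j) := fun j =>
    (show Measurable fun y : EuclideanSpace ℝ (Fin D) => inner ℝ b y by fun_prop) measurableSet_Ioc
  set high : ℤ → Set Ω := fun j =>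
    {ω | s + r + δ * τ ≤ j * δ ∧
      N * (δ * Γ) < ∑ i, (S j).indicator (fun _ => (1 : ℝ)) (X i ω)} with hhigh
  set low : ℤ → Set Ω := fun j =>
    {ω | j * δ + δ ≤ s + r - δ * τ - δ ∧
      ∑ i, (S j).indicator (fun _ => (1 : ℝ)) (X i ω) ≤ N * (δ * Γ)} with hlow
  set J := Finset.Ioc (firstIndex d V τ σ δ) (lastIndex d V τ σ δ) with hJ
  have hbad : ∀ j ∈ J, P.real (high j ∪ low j) ≤ Real.exp (-2 * N * (δ * Γ / 2) ^ 2) := by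
    intro j hj
    rw [hJ, Finset.mem_Ioc] at hj
    by_cases hjh : s + r + δ * τ ≤ j * δ
    · have hp := hM.noisyLaw_upper_slab_le hV hτ hσ hδ hL hb hjh
      refine (measureReal_mono ?_ (measure_ne_top _ _)).trans
        (measure_frequency_ge_le hX hlaw (hSm j) (q := δ * Γ) (t := δ * Γ / 2) (by positivity)
          (by linarith))
      rintro ω (h | h)
      · exact h.2
      · have := h.1
        nlinarith
    by_cases hjl : j * δ + δ ≤ s + r - δ * τ - δ
    · have hj1 : r - 1 - δ * τ - δ ≤ j * δ := by
        have h1 : (firstIndex d V τ σ δ : ℝ) + 1 ≤ j := by exact_mod_cast hj.1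
        rw [firstIndex] at h1
        push_cast at h1
        have h2 := Int.lt_floor_add_one ((r - 1 - δ * τ) / δ)
        have h3 : (r - 1 - δ * τ) / δ ≤ j + 1 := by linarith
        rw [div_le_iff₀ hδ] at h3
        linarith
      have hp := hM.le_noisyLaw_lower_slab hV hτ hσ hδ hδ' hL (by linarith) hb
        (a := j * δ) (by linarith) hjl
      refine (measureReal_mono ?_ (measure_ne_top _ _)).trans
        (measure_frequency_le_le hX hlaw (hSm j) (q := δ * Γ) (t := δ * Γ / 2) (by positivity)
          (by nlinarith [mul_pos hδ hΓ]))
      rintro ω (h | h)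
      · exact absurd h.1 hjh
      · exact h.2
    · have : high j ∪ low j = ∅ := by
        rw [union_empty_iff]
        exact ⟨eq_empty_of_forall_notMem fun ω h => hjh h.1,
          eq_empty_of_forall_notMem fun ω h => hjl h.1⟩
      rw [this, measureReal_empty]
      positivity
  set G := {ω | ∃ t : ℝ, (findDistance d V τ σ ε b (fun i => X i ω)).val = some t ∧ |t - s| < ε}
    with hG
  have hcover : univ ⊆ G ∪ ⋃ j ∈ J, (high j ∪ low j) := by
    intro ω _
    by_contra hcon
    rw [mem_union, not_or] at hcon
    obtain ⟨h1, h2⟩ := hcon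
    simp only [mem_iUnion, not_exists] at h2
    refine h1 (findDistance_val_close hτ hτ1 hε hs b _ (fun j hj1 hj2 hj3 => ?_)
      fun j hj1 hj2 hj3 hj4 => ?_)
    · rw [slabDensity_le_iff hN hδ]
      by_contra hcon
      exact h2 j (Finset.mem_Ioc.2 ⟨hj1, hj2⟩) (Or.inl ⟨hj3, not_le.1 hcon⟩)
    · rw [slabDensity_le_iff hN hδ] at hj4
      exact h2 j (Finset.mem_Ioc.2 ⟨hj1, hj2⟩) (Or.inr ⟨hj3, hj4⟩)
  have h1 : (1 : ℝ) ≤ P.real G + P.real (⋃ j ∈ J, (high j ∪ low j)) := by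
    have := (measureReal_mono hcover (measure_ne_top P _)).trans (measureReal_union_le _ _)
    rwa [probReal_univ] at this
  have h2 : P.real (⋃ j ∈ J, (high j ∪ low j)) ≤
      J.card * Real.exp (-2 * N * (δ * Γ / 2) ^ 2) := by
    refine (measureReal_biUnion_finset_le _ _).trans ((Finset.sum_le_sum hbad).trans ?_)
    rw [Finset.sum_const, nsmul_eq_mul]
  rw [hJ, Int.card_Ioc] at h2
  linarith

end Correctness

end FindDistance

/-! ### Choice of constants and conclusion -/

open FindDistance in
theorem mainTheorem4 :
    ∃ p : Polynomial ℕ, ∀ (d D : ℕ) (V τ σ : ℝ), 1 ≤ d → 0 < V → 0 < τ → 0 < σ →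
      ∃ ε₀ : ℝ, 0 < ε₀ ∧ ∀ ε η : ℝ, 0 < ε → ε < ε₀ → 0 < η → η < 1 / 2 →
        ∀ N : ℕ, FindDistance.sampleBound d V τ σ ε η ≤ (N : ℝ) →
          ∀ b : EuclideanSpace ℝ (Fin D), ‖b‖ = 1 →
            (∀ M : Set (EuclideanSpace ℝ (Fin D)), FindDistance.IsModelManifold d V τ M →
              ∀ {Ω : Type*} [MeasurableSpace Ω] (P : Measure Ω) [IsProbabilityMeasure P]
                (X : Fin N → Ω → EuclideanSpace ℝ (Fin D)),
                iIndepFun X P → (∀ i, HasLaw (X i) (FindDistance.noisyLaw d σ M) P) →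
                1 - η < P.real {ω | ∃ s : ℝ,
                  (FindDistance.findDistance d V τ σ ε b (fun i => X i ω)).val = some s ∧
                  |s - FindDistance.supportFunction M b| < ε}) ∧
            (∀ x : Fin N → EuclideanSpace ℝ (Fin D),
              (FindDistance.findDistance d V τ σ ε b x).ops ≤ p.eval N) := by
  -- The operation bound with `d`, `D` and the number of passes all replaced by `N`.
  refine ⟨.X + 33 + .X * (.X * (.X * 2 + 3) + 8), fun d D V τ σ hd hV hτ hσ => ?_⟩
  -- By `le_sampleRate`, this value of `K` gives `B ≥ 2/δ + 2τ + 4 + d + D`, where `B = σ²R/δ²`: the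
  -- bound of `passes_le` plus one, plus the dimensions.
  obtain ⟨δ₀, hδ₀, hsmall⟩ := exists_small_scale hd hV hτ hσ (2 + (2 * τ + 4 + d + D))
  refine ⟨16 * δ₀, by positivity, fun ε η hε hεlt hη hη' N hN b hb => ?_⟩
  have hδ : 0 < ε / 16 := by positivity
  obtain ⟨hδ', hL, hr, hδσ, hR⟩ := hsmall (ε / 16) hδ (by linarith)
  have hδ1 : ε / 16 ≤ 1 := by
    have h1 := Real.sq_sqrt hδ.le
    have h2 := Real.sqrt_nonneg (ε / 16)
    nlinarith
  have hd0 : (0 : ℝ) ≤ d := d.cast_nonneg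
  have hD0 : (0 : ℝ) ≤ D := D.cast_nonneg
  have hB := le_sampleRate hε hδ1 (by linarith) hR
  have hδinv : 0 < 2 / (ε / 16) := by positivity
  have hNB := le_of_sampleBound_le hη hη' (by linarith) hN
  have hpass := passes_le d V σ hτ hδ
  have hNpos : 0 < N := by
    have : (0 : ℝ) < N := by linarith
    exact_mod_cast this
  have hr5 : 5 ≤ offset d V τ σ (ε / 16) := by
    rw [offset, div_mul_eq_mul_div, le_div_iff₀ (by positivity)]
    nlinarith
  refine ⟨fun M hM Ω _ P _ X hX hlaw => ?_, fun x => ?_⟩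
  · refine lt_of_lt_of_le ?_ (hM.findDistance_correct hd hV hτ hσ hε hNpos hδ' hL hr5 hδ1 hb P X
      hX hlaw)
    refine sub_lt_sub_left (mul_exp_lt_of_sampleBound_le hV hτ hσ hε hη hη' hδσ
      (Nat.cast_nonneg _) ?_ hN) 1
    linarith
  · have hdN : d ≤ N := by
      have : (d : ℝ) ≤ N := by linarith
      exact_mod_cast this
    have hDN : D ≤ N := by
      have : (D : ℝ) ≤ N := by linarith
      exact_mod_cast this
    have hpN : (lastIndex d V τ σ (ε / 16) - firstIndex d V τ σ (ε / 16)).toNat ≤ N := by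
      have : ((lastIndex d V τ σ (ε / 16) - firstIndex d V τ σ (ε / 16)).toNat : ℝ) ≤ N := by
        linarith
      exact_mod_cast this
    refine (findDistance_ops_le x b d V τ σ ε).trans ?_
    simp only [Polynomial.eval_add, Polynomial.eval_mul, Polynomial.eval_X, Polynomial.eval_ofNat]
    gcongr
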